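/- Let $m,n$ be coprime positive integers and let $I\subset(0,\infty)$ be a nonempty open interval. On $M=\{x\in\mathbb R^3: |x|\in I\}$, with spherical coordinates $(r,\theta,\varphi)$, consider a Bertrand Hamiltonian with parameters $m,n$, i.e. the Hamiltonian $$H=\frac12\left(\frac{p_r^2}{h(r)^2}+\frac{p_\theta^2}{r^2}+\frac{p_\varphi^2}{r^2\sin^2\theta}\right)+V(r)$$ on $T^*M$, where $h>0$ and where, for some real constants $K,D,A,G$ and for all $r\in I$ (it is assumed that the quantities below are defined and that $h(r)^2>0$ on $I$), either (Type I) $\;h(r)^2=\dfrac{m^2}{n^2(1+Kr^2)}$ and $V(r)=A\sqrt{r^{-2}+K}+G$, with $1+Kr^2>0$; or (Type II) $\;h(r)^2=\dfrac{2m^2\left(1-Dr^2\pm\sqrt{\Delta(r)}\right)}{n^2\Delta(r)}$ and $V(r)=A\,r^2\left(1-Dr^2\pm\sqrt{\Delta(r)}\right)^{-1}+G$, with $\Delta(r)=(1-Dr^2)^2-Kr^4>0$ and the same choice of sign in $h$ and $V$. Then there is a smooth map $C$ from $T^*M$ to the symmetric tensors of rank $n$ on $\mathbb R^3$ (a symmetric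 rank-$n$ tensor field depending on position $x$ and momentum $p$ in Cartesian coordinates), equivariant under rotations and reflections, which is invariant under the flow of $H$ (each Cartesian component of $C$ is constant along every solution of Hamilton's equations) and is nontrivial in the following sense: some Cartesian component of $C$, together with $H$ and the three components of the angular momentum $L=x\times p$, forms a set of five functions whose differentials are linearly independent on an open dense subset of $T^*M$. The tensor can be chosen so that in the Euclidean Kepler problem (type I, $K=0$, $m=n=1$, $V=A/r+G$) it is the Runge–Lenz vector $p\times L+A\,x/|x|$, and in the Euclidean harmonic oscillator (type II with sign $+$, $K=D=0$, $m=1$, $n=2$, $V=\frac A2 r^2+G$) it is the Fradkin tensor $C_{ij}=p_ip_j+A\,x_ix_j$. Moreover, $H$ is maximally superintegrable: it has five smooth first integrals on $T^*M$, one of them $H$, whose differentials are linearly independent on an open dense subset of $T^*M$, and three of which, including $H$, are in involution. -/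

import Mathlib

open scoped ContDiff

noncomputable section

namespace Bertrand

/-- Euclidean three-space, used as Cartesian coordinates `x = r ω`, `ω ∈ S²`. -/
abbrev E3 : Type := EuclideanSpace ℝ (Fin 3)

/-- Pairs `(x, p)` of a position and a covector (in Cartesian coordinates). -/
abbrev Phase : Type := E3 × E3

/-- The vector product of `E3`. -/
def cross (a b : E3) : E3 := WithLp.toLp 2 (crossProduct a.ofLp b.ofLp)

/-- The angular momentum `L = x × p`. -/
def angMom (z : Phase) : E3 := cross z.1 z.2

/-- The Poisson bracket `{F, G}`. -/
def poisson (F G : Phase → ℝ) (z : Phase) : ℝ :=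
  inner ℝ (gradient (fun x => F (x, z.2)) z.1) (gradient (fun p => G (z.1, p)) z.2) -
    inner ℝ (gradient (fun p => F (z.1, p)) z.2) (gradient (fun x => G (x, z.2)) z.1)

/-- The data of a spherically symmetric natural Hamiltonian: an interval of radii, the metric
`g = h(r)² dr² + r² (dθ² + sin² θ dφ²)` and a radial potential `V(r)`. -/
structure RadialSystem where
  /-- the interval of radii -/
  radii : Set ℝ
  /-- the radial metric coefficient -/
  h : ℝ → ℝ
  /-- the potential -/
  V : ℝ → ℝ
  radii_nonempty : radii.Nonempty
  radii_open : IsOpen radii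
  radii_connected : radii.OrdConnected
  radii_pos : ∀ r ∈ radii, 0 < r
  h_pos : ∀ r ∈ radii, 0 < h r
  h_smooth : ContDiffOn ℝ ∞ h radii
  V_smooth : ContDiffOn ℝ ∞ V radii

namespace RadialSystem

variable (B : RadialSystem)

/-- The cotangent bundle of `M = {x ∈ ℝ³ : |x| ∈ radii}`. -/
def phaseSpace : Set Phase := {z | ‖z.1‖ ∈ B.radii}

/-- The Hamiltonian `H = ½ (p_r² / h(r)² + |L|² / r²) + V(r)`, where `p_r = ⟨x, p⟩ / r` and
`|L|² = p_θ² + p_φ² / sin² θ`. -/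
def H (z : Phase) : ℝ :=
  ((inner ℝ z.1 z.2 / ‖z.1‖) ^ 2 / B.h ‖z.1‖ ^ 2 + ‖angMom z‖ ^ 2 / ‖z.1‖ ^ 2) / 2 + B.V ‖z.1‖

/-- Type I: the metric `m² dr² / (n² (1 + K r²)) + r² dΩ²` with its Kepler potential
`A √(r⁻² + K) + G`. -/
def IsTypeI (m n : ℕ) (K A G : ℝ) : Prop :=
  ∀ r ∈ B.radii, 0 < 1 + K * r ^ 2 ∧
    B.h r ^ 2 = (m : ℝ) ^ 2 / ((n : ℝ) ^ 2 * (1 + K * r ^ 2)) ∧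
    B.V r = A * √((r ^ 2)⁻¹ + K) + G

/-- Type II: the metric
`2 m² (1 - D r² + ε √Δ) dr² / (n² Δ) + r² dΩ²`, `Δ = (1 - D r²)² - K r⁴`, with its
oscillator potential `A r² / (1 - D r² + ε √Δ) + G`; here `ε` is the sign `±`. -/
def IsTypeII (m n : ℕ) (ε D K A G : ℝ) : Prop :=
  ∀ r ∈ B.radii, 0 < (1 - D * r ^ 2) ^ 2 - K * r ^ 4 ∧
    B.h r ^ 2 = 2 * (m : ℝ) ^ 2 * (1 - D * r ^ 2 + ε * √((1 - D * r ^ 2) ^ 2 - K * r ^ 4)) /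
      ((n : ℝ) ^ 2 * ((1 - D * r ^ 2) ^ 2 - K * r ^ 4)) ∧
    B.V r = A * (r ^ 2 / (1 - D * r ^ 2 + ε * √((1 - D * r ^ 2) ^ 2 - K * r ^ 4))) + G

/-- A Bertrand Hamiltonian with coprime positive integer parameters `m`, `n`. -/
def IsBertrand (m n : ℕ) : Prop :=
  0 < m ∧ 0 < n ∧ m.Coprime n ∧
    ((∃ K A G : ℝ, B.IsTypeI m n K A G) ∨
      ∃ ε D K A G : ℝ, (ε = 1 ∨ ε = -1) ∧ B.IsTypeII m n ε D K A G)

/-- The Hamiltonian vector field `(∂H/∂p, -∂H/∂x)`. -/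
def vectorField (z : Phase) : Phase :=
  (gradient (fun p => B.H (z.1, p)) z.2, -gradient (fun x => B.H (x, z.2)) z.1)

/-- `γ` solves Hamilton's equations on the time interval `J`. -/
def IsTrajectory (J : Set ℝ) (γ : ℝ → Phase) : Prop :=
  IsOpen J ∧ J.OrdConnected ∧
    ∀ t ∈ J, γ t ∈ B.phaseSpace ∧ HasDerivAt γ (B.vectorField (γ t)) t

/-- `F` is invariant under the (local) Hamiltonian flow. -/
def IsInvariant {α : Type*} (F : Phase → α) : Prop :=
  ∀ (J : Set ℝ) (γ : ℝ → Phase), B.IsTrajectory J γ → ∀ s ∈ J, ∀ t ∈ J, F (γ s) = F (γ t)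

/-- Functional independence: the differentials are linearly independent on an open dense
subset of phase space. -/
def FunctionallyIndependent {ι : Type*} (F : ι → Phase → ℝ) : Prop :=
  ∃ U : Set Phase, IsOpen U ∧ U ⊆ B.phaseSpace ∧ B.phaseSpace ⊆ closure U ∧
    ∀ z ∈ U, LinearIndependent ℝ (fun i => fderiv ℝ (F i) z)

/-- Maximal superintegrability in three degrees of freedom: there are `5 = 2 · 3 - 1` smooth,
functionally independent first integrals, one of which is `H`, and three of which, including
`H`, are in involution. -/
def IsMaximallySuperintegrable : Prop :=
  ∃ F : Fin 5 → Phase → ℝ, F 0 = B.H ∧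
    (∀ i, ContDiffOn ℝ ∞ (F i) B.phaseSpace ∧ B.IsInvariant (F i)) ∧
    (∀ i j : Fin 5, i < 3 → j < 3 → ∀ z ∈ B.phaseSpace, poisson (F i) (F j) z = 0) ∧
    B.FunctionallyIndependent F

/-- A smooth symmetric tensor field of rank `n`, depending on position and momentum, which is a
tensor under rotations and reflections and whose Cartesian components
`C (e_{i₁}, …, e_{iₙ})` are constants of motion. -/
structure IsInvariantSymmetricTensorField {n : ℕ}
    (C : Phase → MultilinearMap ℝ (fun _ : Fin n => E3) ℝ) : Prop where
  smooth : ∀ v, ContDiffOn ℝ ∞ (fun z => C z v) B.phaseSpace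
  symmetric : ∀ z ∈ B.phaseSpace, ∀ (σ : Equiv.Perm (Fin n)) (v : Fin n → E3),
    C z (fun k => v (σ k)) = C z v
  equivariant : ∀ z ∈ B.phaseSpace, ∀ (R : E3 ≃ₗᵢ[ℝ] E3) (v : Fin n → E3),
    C (R z.1, R z.2) (fun k => R (v k)) = C z v
  invariant : B.IsInvariant C

/-- Nontriviality: some Cartesian component of `C` is functionally independent of the energy and
the three components of the angular momentum. -/
def IsNontrivial {n : ℕ} (C : Phase → MultilinearMap ℝ (fun _ : Fin n => E3) ℝ) : Prop :=
  ∃ c : Fin n → Fin 3, B.FunctionallyIndependent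
    ![B.H, fun z => angMom z 0, fun z => angMom z 1, fun z => angMom z 2,
      fun z => C z (fun k => EuclideanSpace.single (c k) (1 : ℝ))]

end RadialSystem

/-- The Runge--Lenz vector of `½ |p|² + A / |x|`. -/
def rungeLenz (A : ℝ) (z : Phase) : E3 := cross z.2 (angMom z) + (A / ‖z.1‖) • z.1

end Bertrand

end

/-! Write q = |L|². When L ≠ 0, the direction x/|x| turns in the plane orthogonal to L at rate
|L|/r². In a Bertrand system there is a function y(r) such that |L|² y, measured from a centre
depending only on H and |L|², oscillates harmonically in the swept angle with frequency κ = n/m.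
`Linearization` isolates what this needs, and each of the two types supplies an instance.

In ℝ[ω] with ω² = -q, the element displacement + ω · velocity turns at rate κ/r² in units of ω,
while -⟨L × x/|x|, v⟩ + ω ⟨x/|x|, v⟩ turns at rate -1/r². Since m κ = n, a product of m factors of
the first kind and n of the second (`amplitude`) is constant. It is symmetric and n-linear in the
vectors v, and its imaginary part is the tensor C. Using ω instead of i|L| keeps everything smooth
at L = 0.

Nontriviality comes from rotating (x, p) infinitesimally about L (`rotField`). This fixes H, L,
displacement and velocity and turns only the frame factors, so the real and imaginary parts of the
amplitude are, up to nonzero factors where L ≠ 0, each other's derivatives. Neither can vanish on an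
open set, because the multiplicative norm makes the amplitude generically nonzero. Hence C is
independent of H and L (`linearIndependent_fderiv`).

For the Kepler problem C is the Runge–Lenz vector. For the oscillator the construction gives the
rotational derivative of the Fradkin tensor, so that tensor is handled directly, with the same
nonvanishing argument (`fderiv_fradkin`). Superintegrability follows by trading one component of L
for |L|². -/

noncomputable section

namespace Bertrand

local notation "⟪" x ", " y "⟫" => inner ℝ x y

/-! ### Radial coordinates on phase space -/

/-- The generator `⟨x, p⟩` of dilations. -/
def dilation (z : Phase) : ℝ := ⟪z.1, z.2⟫

/-- The radial momentum `p_r`. -/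
def radMom (z : Phase) : ℝ := dilation z / ‖z.1‖

/-- The square of the angular momentum, by Lagrange's identity. -/
def angMomSq (z : Phase) : ℝ := ‖z.1‖ ^ 2 * ‖z.2‖ ^ 2 - dilation z ^ 2

/-- The component of the unit vector `x / |x|` along `v`. -/
def radialComp (v : E3) (z : Phase) : ℝ := ⟪z.1, v⟫ / ‖z.1‖

/-- The component of `L × x / |x|` along `v`. -/
def normalComp (v : E3) (z : Phase) : ℝ := ‖z.1‖ * ⟪z.2, v⟫ - dilation z * ⟪z.1, v⟫ / ‖z.1‖

/-- The infinitesimal rotation about the axis `L`. -/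
def rotField (z : Phase) : Phase :=
  ((-dilation z) • z.1 + (‖z.1‖ ^ 2) • z.2, (-‖z.2‖ ^ 2) • z.1 - (-dilation z) • z.2)

lemma norm_cross_sq (a b : E3) : ‖cross a b‖ ^ 2 = ‖a‖ ^ 2 * ‖b‖ ^ 2 - ⟪a, b⟫ ^ 2 := by
  simp only [EuclideanSpace.real_norm_sq_eq, cross, crossProduct, PiLp.inner_apply,
    Fin.sum_univ_three, LinearMap.mk₂_apply, Matrix.cons_val, RCLike.inner_apply, conj_trivial]
  ring

lemma norm_angMom_sq (z : Phase) : ‖angMom z‖ ^ 2 = angMomSq z := norm_cross_sq _ _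

lemma cross_cross (a b c : E3) : cross a (cross b c) = ⟪a, c⟫ • b - ⟪a, b⟫ • c := by
  ext i
  fin_cases i <;>
  simp [cross, crossProduct, PiLp.inner_apply, Fin.sum_univ_three] <;> ring

lemma angMom_zero (z : Phase) : angMom z 0 = z.1 1 * z.2 2 - z.1 2 * z.2 1 := by
  simp [angMom, cross, crossProduct]

lemma angMom_one (z : Phase) : angMom z 1 = z.1 2 * z.2 0 - z.1 0 * z.2 2 := by
  simp [angMom, cross, crossProduct]

lemma angMom_two (z : Phase) : angMom z 2 = z.1 0 * z.2 1 - z.1 1 * z.2 0 := by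
  simp [angMom, cross, crossProduct]

/-! ### Evolution of the radial quantities along curves -/

section Curves

variable {γ : ℝ → Phase} {ξ η : E3} {a b c t : ℝ}

lemma hasDerivAt_position (hγ : HasDerivAt γ (ξ, η) t) : HasDerivAt (fun s => (γ s).1) ξ t :=
  (hasFDerivAt_fst (𝕜 := ℝ) (p := γ t)).comp_hasDerivAt t hγ

lemma hasDerivAt_momentum (hγ : HasDerivAt γ (ξ, η) t) : HasDerivAt (fun s => (γ s).2) η t :=
  (hasFDerivAt_snd (𝕜 := ℝ) (p := γ t)).comp_hasDerivAt t hγ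

lemma hasDerivAt_norm {f : ℝ → E3} (hf : HasDerivAt f ξ t) (h0 : f t ≠ 0) :
    HasDerivAt (fun s => ‖f s‖) (⟪f t, ξ⟫ / ‖f t‖) t := by
  have h := hf.norm_sq.sqrt (pow_ne_zero 2 (norm_ne_zero_iff.2 h0))
  simp only [Real.sqrt_sq (norm_nonneg _)] at h
  convert h using 1
  field_simp

lemma hasDerivAt_dilation (hγ : HasDerivAt γ (ξ, η) t) :
    HasDerivAt (fun s => dilation (γ s)) (⟪(γ t).1, η⟫ + ⟪ξ, (γ t).2⟫) t :=
  (hasDerivAt_position hγ).inner ℝ (hasDerivAt_momentum hγ)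

lemma hasDerivAt_radMom (hγ : HasDerivAt γ (ξ, η) t) (h0 : (γ t).1 ≠ 0) :
    HasDerivAt (fun s => radMom (γ s))
      (((⟪(γ t).1, η⟫ + ⟪ξ, (γ t).2⟫) * ‖(γ t).1‖ - dilation (γ t) * (⟪(γ t).1, ξ⟫ / ‖(γ t).1‖)) /
        ‖(γ t).1‖ ^ 2) t :=
  (hasDerivAt_dilation hγ).div (hasDerivAt_norm (hasDerivAt_position hγ) h0)
    (norm_ne_zero_iff.2 h0)

lemma hasDerivAt_angMomSq (hγ : HasDerivAt γ (ξ, η) t) :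
    HasDerivAt (fun s => angMomSq (γ s))
      (2 * ⟪(γ t).1, ξ⟫ * ‖(γ t).2‖ ^ 2 + ‖(γ t).1‖ ^ 2 * (2 * ⟪(γ t).2, η⟫) -
        2 * dilation (γ t) * (⟪(γ t).1, η⟫ + ⟪ξ, (γ t).2⟫)) t := by
  have h := ((hasDerivAt_position hγ).norm_sq.mul (hasDerivAt_momentum hγ).norm_sq).sub
    ((hasDerivAt_dilation hγ).pow 2)
  refine h.congr_deriv ?_
  norm_num

/-! Velocities in the Lie algebra of `SL(2)`, acting on the plane spanned by `x` and `p`. -/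

lemma hasDerivAt_angMomSq_sl (hγ : HasDerivAt γ (a • (γ t).1 + b • (γ t).2,
    c • (γ t).1 - a • (γ t).2) t) : HasDerivAt (fun s => angMomSq (γ s)) 0 t := by
  refine (hasDerivAt_angMomSq hγ).congr_deriv ?_
  simp only [inner_add_right, inner_sub_right, inner_smul_right, inner_add_left, inner_smul_left,
    real_inner_self_eq_norm_sq, real_inner_comm (γ t).1 (γ t).2, dilation, conj_trivial]
  ring

/-- A trace-free matrix acting on the pair (x, p) preserves x × p. The Hamiltonian flow, the
rotation about L and the shift of p along x all have this form, so one set of formulas serves all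
three. -/
lemma hasDerivAt_angMom_sl (hγ : HasDerivAt γ (a • (γ t).1 + b • (γ t).2,
    c • (γ t).1 - a • (γ t).2) t) (i : Fin 3) : HasDerivAt (fun s => angMom (γ s) i) 0 t := by
  have hx := fun j => (EuclideanSpace.proj (𝕜 := ℝ) j).hasFDerivAt.comp_hasDerivAt t
    (hasDerivAt_position hγ)
  have hp := fun j => (EuclideanSpace.proj (𝕜 := ℝ) j).hasFDerivAt.comp_hasDerivAt t
    (hasDerivAt_momentum hγ)
  fin_cases i
  · simp only [Fin.zero_eta, angMom_zero]
    refine (((hx 1).mul (hp 2)).sub ((hx 2).mul (hp 1))).congr_deriv ?_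
    simp; ring
  · simp only [Fin.mk_one, angMom_one]
    refine (((hx 2).mul (hp 0)).sub ((hx 0).mul (hp 2))).congr_deriv ?_
    simp; ring
  · simp only [Fin.reduceFinMk, angMom_two]
    refine (((hx 0).mul (hp 1)).sub ((hx 1).mul (hp 0))).congr_deriv ?_
    simp; ring

lemma hasDerivAt_norm_sl (hγ : HasDerivAt γ (a • (γ t).1 + b • (γ t).2,
    c • (γ t).1 - a • (γ t).2) t) (h0 : (γ t).1 ≠ 0) :
    HasDerivAt (fun s => ‖(γ s).1‖) (a * ‖(γ t).1‖ + b * radMom (γ t)) t := by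
  have hr := norm_ne_zero_iff.2 h0
  refine (hasDerivAt_norm (hasDerivAt_position hγ) h0).congr_deriv ?_
  simp only [inner_add_right, inner_smul_right, real_inner_self_eq_norm_sq, radMom, dilation]
  field_simp

lemma hasDerivAt_radMom_sl (hγ : HasDerivAt γ (a • (γ t).1 + b • (γ t).2,
    c • (γ t).1 - a • (γ t).2) t) (h0 : (γ t).1 ≠ 0) :
    HasDerivAt (fun s => radMom (γ s))
      (b * angMomSq (γ t) / ‖(γ t).1‖ ^ 3 + c * ‖(γ t).1‖ - a * radMom (γ t)) t := by
  have hr := norm_ne_zero_iff.2 h0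
  refine (hasDerivAt_radMom hγ h0).congr_deriv ?_
  simp only [inner_add_right, inner_sub_right, inner_smul_right, inner_add_left, inner_smul_left,
    real_inner_self_eq_norm_sq, radMom, dilation, angMomSq, conj_trivial]
  field_simp
  ring

lemma hasDerivAt_radialComp_sl (v : E3) (hγ : HasDerivAt γ (a • (γ t).1 + b • (γ t).2,
    c • (γ t).1 - a • (γ t).2) t) (h0 : (γ t).1 ≠ 0) :
    HasDerivAt (fun s => radialComp v (γ s)) (b / ‖(γ t).1‖ ^ 2 * normalComp v (γ t)) t := by
  have hr := norm_ne_zero_iff.2 h0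
  have h := ((hasDerivAt_position hγ).inner ℝ (hasDerivAt_const t v)).div
    (hasDerivAt_norm_sl hγ h0) hr
  refine h.congr_deriv ?_
  simp only [inner_add_left, inner_smul_left, inner_zero_right, radMom, dilation, normalComp,
    conj_trivial]
  field_simp
  ring

lemma hasDerivAt_normalComp_sl (v : E3) (hγ : HasDerivAt γ (a • (γ t).1 + b • (γ t).2,
    c • (γ t).1 - a • (γ t).2) t) (h0 : (γ t).1 ≠ 0) :
    HasDerivAt (fun s => normalComp v (γ s))
      (-(b / ‖(γ t).1‖ ^ 2) * angMomSq (γ t) * radialComp v (γ t)) t := by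
  have hr := norm_ne_zero_iff.2 h0
  have h := ((hasDerivAt_norm_sl hγ h0).mul
    ((hasDerivAt_momentum hγ).inner ℝ (hasDerivAt_const t v))).sub
    (((hasDerivAt_dilation hγ).mul ((hasDerivAt_position hγ).inner ℝ (hasDerivAt_const t v))).div
    (hasDerivAt_norm_sl hγ h0) hr)
  refine h.congr_deriv ?_
  simp only [inner_sub_right, inner_smul_right, inner_add_left, inner_sub_left,
    inner_smul_left, real_inner_self_eq_norm_sq, inner_zero_right, radMom, dilation, angMomSq,
    radialComp, conj_trivial, Pi.mul_apply]
  field_simp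
  ring

end Curves

/-- Derivatives are computed along straight lines. -/
lemma fderiv_eq_of_hasDerivAt_line {E F : Type*} [NormedAddCommGroup E] [NormedSpace ℝ E]
    [NormedAddCommGroup F] [NormedSpace ℝ F] {f : E → F} {z ζ : E}
    {d : F} (hf : DifferentiableAt ℝ f z)
    (hd : HasDerivAt (fun t : ℝ => f (z + t • ζ)) d 0) : fderiv ℝ f z ζ = d :=
  hf.hasFDerivAt.hasLineDerivAt ζ |>.unique hd

lemma hasDerivAt_line {E : Type*} [NormedAddCommGroup E] [NormedSpace ℝ E] (z ζ : E) :
    HasDerivAt (fun t : ℝ => z + t • ζ) ζ 0 := by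
  simpa using ((hasDerivAt_id (0 : ℝ)).smul_const ζ).const_add z

/-! ### Partial gradients -/

lemma inner_gradient_fst {F : Phase → ℝ} {z : Phase} (hF : DifferentiableAt ℝ F z) (v : E3) :
    ⟪gradient (fun x => F (x, z.2)) z.1, v⟫ = fderiv ℝ F z (v, 0) := by
  have h : HasFDerivAt (fun x => F (x, z.2)) _ z.1 :=
    HasFDerivAt.comp z.1 (show HasFDerivAt F _ (z.1, z.2) from hF.hasFDerivAt)
      (hasFDerivAt_prodMk_left z.1 z.2)
  rw [gradient, InnerProductSpace.toDual_symm_apply, h.fderiv]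
  simp

lemma inner_gradient_snd {F : Phase → ℝ} {z : Phase} (hF : DifferentiableAt ℝ F z) (v : E3) :
    ⟪gradient (fun p => F (z.1, p)) z.2, v⟫ = fderiv ℝ F z (0, v) := by
  have h : HasFDerivAt (fun p => F (z.1, p)) _ z.2 :=
    HasFDerivAt.comp z.2 (show HasFDerivAt F _ (z.1, z.2) from hF.hasFDerivAt)
      (hasFDerivAt_prodMk_right z.1 z.2)
  rw [gradient, InnerProductSpace.toDual_symm_apply, h.fderiv]
  simp

lemma poisson_eq_fderiv {F : Phase → ℝ} {z : Phase} (hF : DifferentiableAt ℝ F z)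
    (G : Phase → ℝ) : poisson F G z = fderiv ℝ F z
      (gradient (fun p => G (z.1, p)) z.2, -gradient (fun x => G (x, z.2)) z.1) := by
  rw [poisson, inner_gradient_fst hF, inner_gradient_snd hF, ← map_sub]
  simp

lemma poisson_self (F : Phase → ℝ) (z : Phase) : poisson F F z = 0 := by
  rw [poisson, real_inner_comm, sub_self]

lemma poisson_symm (F G : Phase → ℝ) (z : Phase) : poisson F G z = -poisson G F z := by
  rw [poisson, poisson, real_inner_comm, real_inner_comm (gradient (fun x => G (x, z.2)) z.1)]
  ring

/-! ### Smoothness -/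

lemma contDiff_dilation : ContDiff ℝ ∞ dilation := contDiff_fst.inner ℝ contDiff_snd

lemma contDiff_angMomSq : ContDiff ℝ ∞ angMomSq :=
  ((contDiff_fst.norm_sq ℝ).mul (contDiff_snd.norm_sq ℝ)).sub (contDiff_dilation.pow 2)

lemma contDiff_coord_fst (i : Fin 3) : ContDiff ℝ ∞ fun z : Phase => z.1 i :=
  (EuclideanSpace.proj (𝕜 := ℝ) i).contDiff.comp contDiff_fst

lemma contDiff_coord_snd (i : Fin 3) : ContDiff ℝ ∞ fun z : Phase => z.2 i :=
  (EuclideanSpace.proj (𝕜 := ℝ) i).contDiff.comp contDiff_snd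

lemma contDiff_angMom (i : Fin 3) : ContDiff ℝ ∞ fun z => angMom z i := by
  fin_cases i
  · simp only [Fin.zero_eta, angMom_zero]
    exact ((contDiff_coord_fst 1).mul (contDiff_coord_snd 2)).sub
      ((contDiff_coord_fst 2).mul (contDiff_coord_snd 1))
  · simp only [Fin.mk_one, angMom_one]
    exact ((contDiff_coord_fst 2).mul (contDiff_coord_snd 0)).sub
      ((contDiff_coord_fst 0).mul (contDiff_coord_snd 2))
  · simp only [Fin.reduceFinMk, angMom_two]
    exact ((contDiff_coord_fst 0).mul (contDiff_coord_snd 1)).sub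
      ((contDiff_coord_fst 1).mul (contDiff_coord_snd 0))

namespace RadialSystem

variable {B : RadialSystem} {z : Phase}

lemma isOpen_phaseSpace (B : RadialSystem) : IsOpen B.phaseSpace :=
  B.radii_open.preimage (continuous_norm.comp continuous_fst)

lemma norm_pos_of_mem (hz : z ∈ B.phaseSpace) : 0 < ‖z.1‖ := B.radii_pos _ hz

lemma position_ne_zero (hz : z ∈ B.phaseSpace) : z.1 ≠ 0 := norm_pos_iff.1 (norm_pos_of_mem hz)

lemma contDiffOn_norm (B : RadialSystem) : ContDiffOn ℝ ∞ (fun z : Phase => ‖z.1‖) B.phaseSpace :=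
  contDiff_fst.contDiffOn.norm ℝ fun _ hz => position_ne_zero hz

lemma contDiffOn_comp_norm {f : ℝ → ℝ} (hf : ContDiffOn ℝ ∞ f B.radii) :
    ContDiffOn ℝ ∞ (fun z : Phase => f ‖z.1‖) B.phaseSpace :=
  hf.comp B.contDiffOn_norm fun _ hz => hz

lemma contDiffOn_radMom (B : RadialSystem) : ContDiffOn ℝ ∞ radMom B.phaseSpace :=
  contDiff_dilation.contDiffOn.div B.contDiffOn_norm fun _ hz => (norm_pos_of_mem hz).ne'

lemma contDiffOn_radialComp (B : RadialSystem) (v : E3) :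
    ContDiffOn ℝ ∞ (radialComp v) B.phaseSpace :=
  (contDiff_fst.inner ℝ contDiff_const).contDiffOn.div B.contDiffOn_norm
    fun _ hz => (norm_pos_of_mem hz).ne'

lemma contDiffOn_normalComp (B : RadialSystem) (v : E3) :
    ContDiffOn ℝ ∞ (normalComp v) B.phaseSpace :=
  (B.contDiffOn_norm.mul (contDiff_snd.inner ℝ contDiff_const).contDiffOn).sub
    ((contDiff_dilation.mul (contDiff_fst.inner ℝ contDiff_const)).contDiffOn.div B.contDiffOn_norm
      fun _ hz => (norm_pos_of_mem hz).ne')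

lemma H_eq (B : RadialSystem) (z : Phase) : B.H z =
    (radMom z ^ 2 / B.h ‖z.1‖ ^ 2 + angMomSq z / ‖z.1‖ ^ 2) / 2 + B.V ‖z.1‖ := by
  rw [H, norm_angMom_sq]; rfl

lemma contDiffOn_H (B : RadialSystem) : ContDiffOn ℝ ∞ B.H B.phaseSpace := by
  have h : B.H = fun z => (radMom z ^ 2 / B.h ‖z.1‖ ^ 2 + angMomSq z / ‖z.1‖ ^ 2) / 2 +
      B.V ‖z.1‖ := funext B.H_eq
  rw [h]
  exact ((((B.contDiffOn_radMom.pow 2).div ((contDiffOn_comp_norm B.h_smooth).pow 2)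
    fun z hz => pow_ne_zero 2 (B.h_pos _ hz).ne').add
    (contDiff_angMomSq.contDiffOn.div (B.contDiffOn_norm.pow 2)
      fun z hz => pow_ne_zero 2 (norm_pos_of_mem hz).ne')).div_const 2).add
    (contDiffOn_comp_norm B.V_smooth)

lemma differentiableAt_of_contDiffOn {f : Phase → ℝ} (hf : ContDiffOn ℝ ∞ f B.phaseSpace)
    (hz : z ∈ B.phaseSpace) : DifferentiableAt ℝ f z :=
  (hf.contDiffAt (B.isOpen_phaseSpace.mem_nhds hz)).differentiableAt (by simp)

lemma hasDerivAt_of_contDiffOn_radii {f : ℝ → ℝ} {r : ℝ} (hf : ContDiffOn ℝ ∞ f B.radii)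
    (hr : r ∈ B.radii) : HasDerivAt f (deriv f r) r :=
  ((hf.contDiffAt (B.radii_open.mem_nhds hr)).differentiableAt (by simp)).hasDerivAt

lemma hasDerivAt_eq_of_eqOn {f g : ℝ → ℝ} {f' g' r : ℝ} (hr : r ∈ B.radii)
    (h : ∀ s ∈ B.radii, f s = g s) (hf : HasDerivAt f f' r) (hg : HasDerivAt g g' r) : f' = g' :=
  hf.unique (hg.congr_of_eventuallyEq
    (Filter.eventuallyEq_of_mem (B.radii_open.mem_nhds hr) h))

/-! ### Hamilton's equations -/

section

variable {γ : ℝ → Phase} {t r' p' q' : ℝ}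

lemma hasDerivAt_H (hz : γ t ∈ B.phaseSpace) (hr : HasDerivAt (fun s => ‖(γ s).1‖) r' t)
    (hp : HasDerivAt (fun s => radMom (γ s)) p' t) (hq : HasDerivAt (fun s => angMomSq (γ s)) q' t) :
    HasDerivAt (fun s => B.H (γ s))
      (radMom (γ t) * p' / B.h ‖(γ t).1‖ ^ 2 -
        radMom (γ t) ^ 2 * deriv B.h ‖(γ t).1‖ * r' / B.h ‖(γ t).1‖ ^ 3 +
        q' / (2 * ‖(γ t).1‖ ^ 2) - angMomSq (γ t) * r' / ‖(γ t).1‖ ^ 3 +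
        deriv B.V ‖(γ t).1‖ * r') t := by
  have h0 := (norm_pos_of_mem hz).ne'
  have hh0 := (B.h_pos _ hz).ne'
  have hh := (hasDerivAt_of_contDiffOn_radii B.h_smooth hz).comp t hr
  have hV := (hasDerivAt_of_contDiffOn_radii B.V_smooth hz).comp t hr
  have h := ((((hp.pow 2).div (hh.pow 2) (pow_ne_zero 2 hh0)).add
    (hq.div (hr.pow 2) (pow_ne_zero 2 h0))).div_const 2).add hV
  simp only [H_eq]
  refine h.congr_deriv ?_
  simp only [Function.comp_apply, Pi.pow_apply]
  field_simp
  push_cast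
  ring

end

/-- The coefficient of `x` in the velocity. -/
def velCoeff (B : RadialSystem) (z : Phase) : ℝ :=
  (1 / B.h ‖z.1‖ ^ 2 - 1) * radMom z / ‖z.1‖

/-- The coefficient of `x` in the force. -/
def forceCoeff (B : RadialSystem) (z : Phase) : ℝ :=
  (B.velCoeff z * radMom z + radMom z ^ 2 * deriv B.h ‖z.1‖ / B.h ‖z.1‖ ^ 3 -
    deriv B.V ‖z.1‖) / ‖z.1‖

/-- By spherical symmetry, velocity and force lie in the span of x and p; the resulting matrix is
trace-free with b = 1, so conservation of L and the evolution equations reduce to the sl(2)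
formulas. -/
lemma vectorField_eq (hz : z ∈ B.phaseSpace) : B.vectorField z =
    (B.velCoeff z • z.1 + (1 : ℝ) • z.2, B.forceCoeff z • z.1 - B.velCoeff z • z.2) := by
  have h0 := (norm_pos_of_mem hz).ne'
  have hh0 := (B.h_pos _ hz).ne'
  have hd := differentiableAt_of_contDiffOn B.contDiffOn_H hz
  have key : ∀ ξ η : E3, fderiv ℝ B.H z (ξ, η) =
      ⟪-(B.forceCoeff z • z.1 - B.velCoeff z • z.2), ξ⟫ + ⟪B.velCoeff z • z.1 + z.2, η⟫ := by
    intro ξ η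
    have hl := hasDerivAt_line z (ξ, η)
    have e0 : z + (0 : ℝ) • ((ξ, η) : Phase) = z := by simp
    have hx := hasDerivAt_norm (hasDerivAt_position hl) (by simpa using position_ne_zero hz)
    have hp := hasDerivAt_radMom hl (by simpa using position_ne_zero hz)
    have hq := hasDerivAt_angMomSq hl
    refine fderiv_eq_of_hasDerivAt_line hd
      ((hasDerivAt_H (B := B) (by simpa using hz) hx hp hq).congr_deriv ?_)
    simp only [e0, inner_add_left, inner_sub_left, inner_neg_left, inner_smul_left, conj_trivial,
      forceCoeff, velCoeff, radMom, angMomSq, dilation, real_inner_comm ξ z.2]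
    field_simp
    ring
  refine Prod.ext (ext_inner_right ℝ fun v => ?_) (ext_inner_right ℝ fun v => ?_)
  · rw [vectorField, inner_gradient_snd hd, key]
    simp
  · rw [vectorField, inner_neg_left, inner_gradient_fst hd, key, inner_neg_left,
      inner_zero_right, add_zero, neg_neg]

section

variable {γ : ℝ → Phase} {t : ℝ}

lemma hasDerivAt_norm_flow (hz : γ t ∈ B.phaseSpace)
    (hγ : HasDerivAt γ (B.vectorField (γ t)) t) :
    HasDerivAt (fun s => ‖(γ s).1‖) (radMom (γ t) / B.h ‖(γ t).1‖ ^ 2) t := by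
  rw [vectorField_eq hz] at hγ
  have h0 := (norm_pos_of_mem hz).ne'
  refine (hasDerivAt_norm_sl hγ (position_ne_zero hz)).congr_deriv ?_
  rw [velCoeff]
  field_simp
  ring

lemma hasDerivAt_radMom_flow (hz : γ t ∈ B.phaseSpace)
    (hγ : HasDerivAt γ (B.vectorField (γ t)) t) :
    HasDerivAt (fun s => radMom (γ s)) (angMomSq (γ t) / ‖(γ t).1‖ ^ 3 +
      radMom (γ t) ^ 2 * deriv B.h ‖(γ t).1‖ / B.h ‖(γ t).1‖ ^ 3 - deriv B.V ‖(γ t).1‖) t := by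
  rw [vectorField_eq hz] at hγ
  have h0 := (norm_pos_of_mem hz).ne'
  refine (hasDerivAt_radMom_sl hγ (position_ne_zero hz)).congr_deriv ?_
  rw [forceCoeff]
  field_simp
  ring

lemma hasDerivAt_H_flow (hz : γ t ∈ B.phaseSpace) (hγ : HasDerivAt γ (B.vectorField (γ t)) t) :
    HasDerivAt (fun s => B.H (γ s)) 0 t := by
  have h0 := (norm_pos_of_mem hz).ne'
  have hh0 := (B.h_pos _ hz).ne'
  have hq := hasDerivAt_angMomSq_sl (by rwa [vectorField_eq hz] at hγ)
  refine (hasDerivAt_H hz (hasDerivAt_norm_flow hz hγ) (hasDerivAt_radMom_flow hz hγ)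
    hq).congr_deriv ?_
  field_simp
  ring

end

/-- A function is invariant if its derivative vanishes along the Hamiltonian flow. -/
lemma isInvariant_of_hasDerivAt {F : Phase → ℝ} (hF : ∀ (γ : ℝ → Phase) (t : ℝ),
    γ t ∈ B.phaseSpace → HasDerivAt γ (B.vectorField (γ t)) t →
      HasDerivAt (fun s => F (γ s)) 0 t) : B.IsInvariant F := by
  rintro J γ ⟨hJ, hJc, hγ⟩ s hs t ht
  have hd : ∀ u ∈ J, HasDerivAt (fun s => F (γ s)) 0 u := fun u hu => hF γ u (hγ u hu).1 (hγ u hu).2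
  obtain ⟨a, ha⟩ := hJ.exists_is_const_of_deriv_eq_zero hJc.isPreconnected
    (fun u hu => (hd u hu).differentiableAt.differentiableWithinAt) fun u hu => (hd u hu).deriv
  exact (ha s hs).trans (ha t ht).symm

lemma isInvariant_H (B : RadialSystem) : B.IsInvariant B.H :=
  isInvariant_of_hasDerivAt fun _ _ hz hγ => hasDerivAt_H_flow hz hγ

lemma isInvariant_angMom (B : RadialSystem) (i : Fin 3) : B.IsInvariant fun z => angMom z i :=
  isInvariant_of_hasDerivAt fun _ _ hz hγ =>
    hasDerivAt_angMom_sl (by rwa [vectorField_eq hz] at hγ) i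

lemma isInvariant_angMomSq (B : RadialSystem) : B.IsInvariant angMomSq :=
  isInvariant_of_hasDerivAt fun _ _ hz hγ =>
    hasDerivAt_angMomSq_sl (by rwa [vectorField_eq hz] at hγ)

end RadialSystem

/-! ### Products in the algebra `ℝ[ω]`, `ω² = -q`, with variable `q` -/

section Products

variable {ι : Type*}

/-- The algebra itself varies with the point through q, so both parts are tracked as polynomials in
q and the parts of the factors; no square root of q appears. -/
lemma contDiffOn_prod_re_im {E : Type*} [NormedAddCommGroup E] [NormedSpace ℝ E] {s : Set E}
    {q : E → ℝ} {f g : ι → E → ℝ} (hq : ContDiffOn ℝ ∞ q s) (S : Finset ι)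
    (hf : ∀ i, ContDiffOn ℝ ∞ (f i) s) (hg : ∀ i, ContDiffOn ℝ ∞ (g i) s) :
    ContDiffOn ℝ ∞ (fun z => (∏ i ∈ S, (⟨f i z, g i z⟩ : QuadraticAlgebra ℝ (-q z) 0)).re) s ∧
    ContDiffOn ℝ ∞ (fun z => (∏ i ∈ S, (⟨f i z, g i z⟩ : QuadraticAlgebra ℝ (-q z) 0)).im) s := by
  classical
  induction S using Finset.induction_on with
  | empty => exact ⟨contDiffOn_const, contDiffOn_const⟩
  | insert i S hi ih =>
    simp only [Finset.prod_insert hi, QuadraticAlgebra.re_mul, QuadraticAlgebra.im_mul, zero_mul,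
      add_zero]
    exact ⟨((hf i).mul ih.1).add ((hq.neg.mul (hg i)).mul ih.2),
      ((hf i).mul ih.2).add ((hg i).mul ih.1)⟩

/-- If each factor rotates with angular velocity `θ i`, the product rotates with the sum. -/
lemma hasDerivAt_prod_re_im {q : ℝ → ℝ} {f g : ι → ℝ → ℝ} {θ : ι → ℝ} {t : ℝ}
    (hq : HasDerivAt q 0 t) (S : Finset ι)
    (hf : ∀ i, HasDerivAt (f i) (-(θ i * q t * g i t)) t)
    (hg : ∀ i, HasDerivAt (g i) (θ i * f i t) t) :
    HasDerivAt (fun s => (∏ i ∈ S, (⟨f i s, g i s⟩ : QuadraticAlgebra ℝ (-q s) 0)).re)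
      (-((∑ i ∈ S, θ i) * q t *
        (∏ i ∈ S, (⟨f i t, g i t⟩ : QuadraticAlgebra ℝ (-q t) 0)).im)) t ∧
    HasDerivAt (fun s => (∏ i ∈ S, (⟨f i s, g i s⟩ : QuadraticAlgebra ℝ (-q s) 0)).im)
      ((∑ i ∈ S, θ i) * (∏ i ∈ S, (⟨f i t, g i t⟩ : QuadraticAlgebra ℝ (-q t) 0)).re) t := by
  classical
  induction S using Finset.induction_on with
  | empty =>
    simp only [Finset.sum_empty, zero_mul, neg_zero]
    exact ⟨hasDerivAt_const t 1, hasDerivAt_const t 0⟩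
  | insert i S hi ih =>
    simp only [Finset.prod_insert hi, Finset.sum_insert hi, QuadraticAlgebra.re_mul,
      QuadraticAlgebra.im_mul, zero_mul, add_zero]
    refine ⟨(((hf i).mul ih.1).add ((hq.neg.mul (hg i)).mul ih.2)).congr_deriv ?_,
      (((hf i).mul ih.2).add ((hg i).mul ih.1)).congr_deriv ?_⟩
    · simp only [Pi.mul_apply, Pi.neg_apply]
      ring
    · ring

/-- The norm a² + q b² is multiplicative, and positive definite for q > 0. -/
lemma prod_ne_zero_of_norm_pos {q : ℝ} (hq : 0 < q) {f g : ι → ℝ} (S : Finset ι)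
    (h : ∀ i, f i ≠ 0 ∨ g i ≠ 0) :
    ∏ i ∈ S, (⟨f i, g i⟩ : QuadraticAlgebra ℝ (-q) 0) ≠ 0 := by
  intro h0
  have h1 := congrArg QuadraticAlgebra.norm h0
  rw [map_prod, QuadraticAlgebra.norm_zero] at h1
  obtain ⟨i, -, hi⟩ := Finset.prod_eq_zero_iff.1 h1
  rw [QuadraticAlgebra.norm_def] at hi
  have hf : f i = 0 := by nlinarith [mul_nonneg hq.le (mul_self_nonneg (g i)), mul_self_nonneg (f i)]
  have hg : g i = 0 := by
    have : q * (g i * g i) = 0 := by rw [hf] at hi; linarith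
    simpa [hq.ne'] using this
  exact (h i).elim (· hf) (· hg)

end Products

/-! ### Linearization of the orbit equation -/

/-- A function `y` of the radius, with `y' = -κ β h² / r²`, such that `β p_r` is conjugate to it
and the energy relation
`(β p_r)² + |L|² y² + 2 (cE H + cL |L|² + c₀) y = dE H + dL |L|² + d₀`
holds. In terms of the angle swept by the orbit, `y` then satisfies a linear equation with
frequency `κ`. -/
structure Linearization (B : RadialSystem) (κ : ℝ) where
  y : ℝ → ℝ
  β : ℝ → ℝ
  cE : ℝ
  cL : ℝ
  c₀ : ℝ
  dE : ℝ
  dL : ℝ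
  d₀ : ℝ
  y_smooth : ContDiffOn ℝ ∞ y B.radii
  β_smooth : ContDiffOn ℝ ∞ β B.radii
  β_ne_zero : ∀ r ∈ B.radii, β r ≠ 0
  hasDerivAt_y : ∀ r ∈ B.radii, HasDerivAt y (-(κ * β r * B.h r ^ 2 / r ^ 2)) r
  -- The three identities below are the coefficients of p_r², |L|² and 1 in the energy relation.
  radial : ∀ r ∈ B.radii, B.h r ^ 2 * β r ^ 2 = dE / 2 - cE * y r
  angular : ∀ r ∈ B.radii,
    y r ^ 2 + 2 * cL * y r + cE * y r * (r ^ 2)⁻¹ = dL + dE / 2 * (r ^ 2)⁻¹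
  potential : ∀ r ∈ B.radii, 2 * cE * (B.V r * y r) + 2 * c₀ * y r = dE * B.V r + d₀

namespace Linearization

variable {B : RadialSystem} {κ : ℝ} (D : Linearization B κ)

/-- The displacement of `|L|² y` from its centre of oscillation. -/
def displacement (z : Phase) : ℝ :=
  angMomSq z * D.y ‖z.1‖ + (D.cE * B.H z + D.cL * angMomSq z + D.c₀)

/-- The velocity conjugate to the displacement. -/
def velocity (z : Phase) : ℝ := D.β ‖z.1‖ * radMom z

lemma contDiffOn_displacement : ContDiffOn ℝ ∞ D.displacement B.phaseSpace :=
  (contDiff_angMomSq.contDiffOn.mul (RadialSystem.contDiffOn_comp_norm D.y_smooth)).add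
    (((contDiffOn_const.mul B.contDiffOn_H).add
      (contDiffOn_const.mul contDiff_angMomSq.contDiffOn)).add contDiffOn_const)

lemma contDiffOn_velocity : ContDiffOn ℝ ∞ D.velocity B.phaseSpace :=
  (RadialSystem.contDiffOn_comp_norm D.β_smooth).mul B.contDiffOn_radMom

section

variable {γ : ℝ → Phase} {t : ℝ}

open RadialSystem

lemma hasDerivAt_displacement_flow (hz : γ t ∈ B.phaseSpace)
    (hγ : HasDerivAt γ (B.vectorField (γ t)) t) :
    HasDerivAt (fun s => D.displacement (γ s))
      (-(κ / ‖(γ t).1‖ ^ 2 * angMomSq (γ t) * D.velocity (γ t))) t := by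
  have h0 := (norm_pos_of_mem hz).ne'
  have hh0 := (B.h_pos _ hz).ne'
  have hq := hasDerivAt_angMomSq_sl (by rwa [vectorField_eq hz] at hγ)
  have h := (hq.mul ((D.hasDerivAt_y _ hz).comp t (hasDerivAt_norm_flow hz hγ))).add
    ((((hasDerivAt_H_flow hz hγ).const_mul D.cE).add (hq.const_mul D.cL)).add_const D.c₀)
  refine h.congr_deriv ?_
  rw [velocity]
  field_simp
  ring

/-- Differentiating a quadratic energy relation and dividing by the derivative of y, a nonzero
multiple of β h² when κ ≠ 0, leaves a linear equation. The proof does this coefficient by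
coefficient. -/
lemma hasDerivAt_velocity_flow (hz : γ t ∈ B.phaseSpace)
    (hγ : HasDerivAt γ (B.vectorField (γ t)) t) :
    HasDerivAt (fun s => D.velocity (γ s)) (κ / ‖(γ t).1‖ ^ 2 * D.displacement (γ t)) t := by
  have h0 := (norm_pos_of_mem hz).ne'
  have hh0 := (B.h_pos _ hz).ne'
  have hβ0 := D.β_ne_zero _ hz
  have hh := hasDerivAt_of_contDiffOn_radii B.h_smooth hz
  have hV := hasDerivAt_of_contDiffOn_radii B.V_smooth hz
  have hβ := hasDerivAt_of_contDiffOn_radii D.β_smooth hz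
  have hy := D.hasDerivAt_y _ hz
  have hi := ((hasDerivAt_id (‖(γ t).1‖)).pow 2).inv (by simpa using h0)
  have e1 := D.radial _ hz
  have e1' := hasDerivAt_eq_of_eqOn hz D.radial ((hh.pow 2).mul (hβ.pow 2))
    ((hy.const_mul D.cE).const_sub (D.dE / 2))
  have e2' := hasDerivAt_eq_of_eqOn hz D.angular
    (((hy.pow 2).add (hy.const_mul (2 * D.cL))).add ((hy.const_mul D.cE).mul hi))
    ((hi.const_mul (D.dE / 2)).const_add D.dL)
  have e3' := hasDerivAt_eq_of_eqOn hz D.potential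
    (((hV.mul hy).const_mul (2 * D.cE)).add (hy.const_mul (2 * D.c₀)))
    ((hV.const_mul D.dE).add_const D.d₀)
  refine ((hβ.comp t (hasDerivAt_norm_flow hz hγ)).mul
    (hasDerivAt_radMom_flow hz hγ)).congr_deriv ?_
  simp only [displacement, H_eq, Function.comp_apply, Pi.pow_apply, id] at *
  generalize ‖(γ t).1‖ = r at *
  generalize B.h r = h at *
  generalize deriv B.h r = h' at *
  generalize deriv B.V r = V' at *
  generalize deriv D.β r = β' at *
  generalize B.V r = V at *
  generalize D.β r = β at *
  generalize D.y r = y at *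
  generalize radMom (γ t) = p at *
  generalize angMomSq (γ t) = q at *
  norm_num at e1' e2' e3'
  -- `kp`, `kq`, `kc` match the terms in p_r², |L|² and 1. In the last two, `e1` replaces dE/2 - cE
  -- y by h² β², so that β h² cancels.
  have kp : 2 * (β' * h + β * h') * r ^ 2 = κ * D.cE * h := by
    field_simp at e1'
    linear_combination e1'
  have kq : 2 * β * r = κ * (2 * y * r ^ 2 + D.cE + 2 * D.cL * r ^ 2) := by
    refine mul_left_cancel₀ (mul_ne_zero hβ0 (pow_ne_zero 2 hh0)) ?_
    field_simp at e2'
    linear_combination 2 * r * e1 + e2'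
  have kc : -(β * V') * r ^ 2 = κ * (D.cE * V + D.c₀) := by
    refine mul_left_cancel₀ (mul_ne_zero hβ0 (pow_ne_zero 2 hh0)) ?_
    field_simp at e3'
    linear_combination -V' * r ^ 2 * e1 + e3' / 2
  field_simp
  linear_combination p ^ 2 * r ^ 2 * kp + h ^ 3 * q * kq + 2 * r ^ 2 * h ^ 3 * kc
end

end Linearization

/-! ### Functional independence -/

/-- The linear vector field on phase space given by a matrix in `sl(2)`. -/
def slField (a b c : ℝ) (z : Phase) : Phase := (a • z.1 + b • z.2, c • z.1 - a • z.2)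

lemma rotField_eq (z : Phase) :
    rotField z = slField (-dilation z) (‖z.1‖ ^ 2) (-‖z.2‖ ^ 2) z := rfl

lemma hasDerivAt_line_slField (z : Phase) (a b c : ℝ) :
    HasDerivAt (fun t : ℝ => z + t • slField a b c z)
      (a • (z + (0 : ℝ) • slField a b c z).1 + b • (z + (0 : ℝ) • slField a b c z).2,
        c • (z + (0 : ℝ) • slField a b c z).1 - a • (z + (0 : ℝ) • slField a b c z).2) 0 :=
  (hasDerivAt_line z (slField a b c z)).congr_deriv (by simp [slField])

lemma fderiv_angMom_slField (z : Phase) (a b c : ℝ) (i : Fin 3) :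
    fderiv ℝ (fun z => angMom z i) z (slField a b c z) = 0 :=
  fderiv_eq_of_hasDerivAt_line ((contDiff_angMom i).differentiable (by simp) z)
    (hasDerivAt_angMom_sl (hasDerivAt_line_slField z a b c) i)

lemma angMomSq_eq_sum (z : Phase) :
    angMomSq z = angMom z 0 ^ 2 + angMom z 1 ^ 2 + angMom z 2 ^ 2 := by
  rw [← norm_angMom_sq, EuclideanSpace.real_norm_sq_eq, Fin.sum_univ_three]

section

variable (z : Phase) (ξ η : E3)

lemma hasDerivAt_coord_line (i : Fin 3) :
    HasDerivAt (fun t : ℝ => (z + t • ((ξ, η) : Phase)).1 i) (ξ i) 0 ∧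
    HasDerivAt (fun t : ℝ => (z + t • ((ξ, η) : Phase)).2 i) (η i) 0 :=
  ⟨(EuclideanSpace.proj (𝕜 := ℝ) i).hasFDerivAt.comp_hasDerivAt (0 : ℝ)
    (hasDerivAt_position (hasDerivAt_line z (ξ, η))),
   (EuclideanSpace.proj (𝕜 := ℝ) i).hasFDerivAt.comp_hasDerivAt (0 : ℝ)
    (hasDerivAt_momentum (hasDerivAt_line z (ξ, η)))⟩

lemma fderiv_angMom_zero : fderiv ℝ (fun z => angMom z 0) z (ξ, η) =
    ξ 1 * z.2 2 - ξ 2 * z.2 1 + (z.1 1 * η 2 - z.1 2 * η 1) := by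
  refine fderiv_eq_of_hasDerivAt_line ((contDiff_angMom 0).differentiable (by simp) z) ?_
  have h := hasDerivAt_coord_line z ξ η
  simp only [angMom_zero]
  refine (((h 1).1.mul (h 2).2).sub ((h 2).1.mul (h 1).2)).congr_deriv ?_
  simp
  ring

lemma fderiv_angMom_one : fderiv ℝ (fun z => angMom z 1) z (ξ, η) =
    ξ 2 * z.2 0 - ξ 0 * z.2 2 + (z.1 2 * η 0 - z.1 0 * η 2) := by
  refine fderiv_eq_of_hasDerivAt_line ((contDiff_angMom 1).differentiable (by simp) z) ?_
  have h := hasDerivAt_coord_line z ξ η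
  simp only [angMom_one]
  refine (((h 2).1.mul (h 0).2).sub ((h 0).1.mul (h 2).2)).congr_deriv ?_
  simp
  ring

lemma fderiv_angMom_two : fderiv ℝ (fun z => angMom z 2) z (ξ, η) =
    ξ 0 * z.2 1 - ξ 1 * z.2 0 + (z.1 0 * η 1 - z.1 1 * η 0) := by
  refine fderiv_eq_of_hasDerivAt_line ((contDiff_angMom 2).differentiable (by simp) z) ?_
  have h := hasDerivAt_coord_line z ξ η
  simp only [angMom_two]
  refine (((h 0).1.mul (h 1).2).sub ((h 1).1.mul (h 0).2)).congr_deriv ?_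
  simp
  ring

end

/-- Off the zero level of `L`, the differentials of its components are independent. -/
lemma angMom_coeff_eq_zero {z : Phase} (hL : angMomSq z ≠ 0) {a b c : ℝ}
    (h : ∀ ζ, a * fderiv ℝ (fun z => angMom z 0) z ζ + b * fderiv ℝ (fun z => angMom z 1) z ζ +
      c * fderiv ℝ (fun z => angMom z 2) z ζ = 0) : a = 0 ∧ b = 0 ∧ c = 0 := by
  have e := fun i => h (EuclideanSpace.single i 1, 0)
  have f := fun i => h (0, EuclideanSpace.single i 1)
  simp only [fderiv_angMom_zero, fderiv_angMom_one, fderiv_angMom_two] at e f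
  have e0 := e 0
  have e1 := e 1
  have e2 := e 2
  have f0 := f 0
  have f1 := f 1
  have f2 := f 2
  simp at e0 e1 e2 f0 f1 f2
  set x := z.1
  set p := z.2
  -- With α = (a, b, c), the equations say p × α = 0 and α × x = 0. The combinations are Cramer's
  -- rule for α in the basis x, p, L, whose determinant is |L|².
  have key : a * angMomSq z = 0 ∧ b * angMomSq z = 0 ∧ c * angMomSq z = 0 := by
    rw [angMomSq_eq_sum, angMom_zero, angMom_one, angMom_two]
    refine ⟨?_, ?_, ?_⟩
    · linear_combination (x 1 * p 2 - x 2 * p 1) * (-p 0 * f0 + x 1 * e1 + x 2 * e2) +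
        (x 2 * p 0 - x 0 * p 2) * (-p 0 * f1 - x 0 * e1) +
        (x 0 * p 1 - x 1 * p 0) * (-p 0 * f2 - x 0 * e2)
    · linear_combination (x 1 * p 2 - x 2 * p 1) * (-p 1 * f0 - x 1 * e0) +
        (x 2 * p 0 - x 0 * p 2) * (-p 1 * f1 + x 2 * e2 + x 0 * e0) +
        (x 0 * p 1 - x 1 * p 0) * (-p 1 * f2 - x 1 * e2)
    · linear_combination (x 1 * p 2 - x 2 * p 1) * (-p 2 * f0 - x 2 * e0) +
        (x 2 * p 0 - x 0 * p 2) * (-p 2 * f1 - x 2 * e1) +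
        (x 0 * p 1 - x 1 * p 0) * (-p 2 * f2 + x 0 * e0 + x 1 * e1)
  simpa [hL] using key

namespace RadialSystem

variable {B : RadialSystem} {z : Phase}

section

variable {a b c : ℝ}

lemma fderiv_H_slField (hz : z ∈ B.phaseSpace) :
    fderiv ℝ B.H z (slField a b c z) =
      radMom z * (b * angMomSq z / ‖z.1‖ ^ 3 + c * ‖z.1‖ - a * radMom z) / B.h ‖z.1‖ ^ 2 -
      radMom z ^ 2 * deriv B.h ‖z.1‖ * (a * ‖z.1‖ + b * radMom z) / B.h ‖z.1‖ ^ 3 -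
      angMomSq z * (a * ‖z.1‖ + b * radMom z) / ‖z.1‖ ^ 3 +
      deriv B.V ‖z.1‖ * (a * ‖z.1‖ + b * radMom z) := by
  have hl := hasDerivAt_line_slField z a b c
  have e0 : z + (0 : ℝ) • slField a b c z = z := by simp
  have h1 : (z + (0 : ℝ) • slField a b c z).1 ≠ 0 := by simpa using position_ne_zero hz
  refine fderiv_eq_of_hasDerivAt_line (differentiableAt_of_contDiffOn B.contDiffOn_H hz)
    ((hasDerivAt_H (B := B) (by rwa [e0]) (hasDerivAt_norm_sl hl h1) (hasDerivAt_radMom_sl hl h1)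
      (hasDerivAt_angMomSq_sl hl)).congr_deriv ?_)
  simp only [e0]
  ring

lemma fderiv_H_rotField (hz : z ∈ B.phaseSpace) : fderiv ℝ B.H z (rotField z) = 0 := by
  have h0 := (norm_pos_of_mem hz).ne'
  rw [rotField_eq, fderiv_H_slField hz, angMomSq, radMom]
  field_simp
  ring

/-- Shifting p along x keeps r and L and changes only p_r, so this field separates H from the
components of L. -/
lemma fderiv_H_slField_lower (hz : z ∈ B.phaseSpace) :
    fderiv ℝ B.H z (slField 0 0 1 z) = dilation z / B.h ‖z.1‖ ^ 2 := by
  have h0 := (norm_pos_of_mem hz).ne'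
  have hh0 := (B.h_pos _ hz).ne'
  rw [fderiv_H_slField hz, radMom]
  field_simp
  ring

end

/-- Two vector fields make the relation triangular: `rotField` kills H and L but not F, and the
shift of p along x kills L but not H. Only the components of L remain. -/
lemma linearIndependent_fderiv (hz : z ∈ B.phaseSpace) (hd : dilation z ≠ 0)
    (hL : angMomSq z ≠ 0) {F : Phase → ℝ} (hF : fderiv ℝ F z (rotField z) ≠ 0) :
    LinearIndependent ℝ (fun i => fderiv ℝ (![B.H, fun z => angMom z 0, fun z => angMom z 1,
      fun z => angMom z 2, F] i) z) := by
  rw [Fintype.linearIndependent_iff]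
  intro g hg
  have h : ∀ ζ, g 0 * fderiv ℝ B.H z ζ + g 1 * fderiv ℝ (fun z => angMom z 0) z ζ +
      g 2 * fderiv ℝ (fun z => angMom z 1) z ζ + g 3 * fderiv ℝ (fun z => angMom z 2) z ζ +
      g 4 * fderiv ℝ F z ζ = 0 := by
    intro ζ
    simpa [Fin.sum_univ_five] using DFunLike.congr_fun hg ζ
  have h4 : g 4 = 0 := by
    have := h (rotField z)
    rw [fderiv_H_rotField hz, rotField_eq, fderiv_angMom_slField, fderiv_angMom_slField,
      fderiv_angMom_slField, ← rotField_eq] at this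
    simpa [hF] using this
  have h0 : g 0 = 0 := by
    have := h (slField 0 0 1 z)
    rw [fderiv_H_slField_lower hz, fderiv_angMom_slField, fderiv_angMom_slField,
      fderiv_angMom_slField, h4] at this
    simpa [hd, (B.h_pos _ hz).ne'] using this
  obtain ⟨h1, h2, h3⟩ := angMom_coeff_eq_zero hL (a := g 1) (b := g 2) (c := g 3)
    fun ζ => by simpa [h0, h4] using h ζ
  intro i
  fin_cases i <;> assumption

end RadialSystem

/-! ### Generic points -/

lemma eventually_add_mul_ne_zero (a : ℝ) {b : ℝ} (hb : b ≠ 0) :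
    ∀ᶠ t in nhdsWithin (0 : ℝ) {0}ᶜ, a + t * b ≠ 0 := by
  by_cases ha : a = 0
  · filter_upwards [self_mem_nhdsWithin] with t ht
    simpa [ha, hb] using ht
  · refine nhdsWithin_le_nhds (ContinuousAt.eventually_ne ?_ (by simpa using ha))
    fun_prop

/-- Points with `x₀ ≠ 0`, `⟨x, p⟩ ≠ 0` and `L₁ ≠ 0` are dense. -/
lemma exists_generic_mem {O : Set Phase} (hO : IsOpen O) (hne : O.Nonempty) :
    ∃ z ∈ O, z.1 0 ≠ 0 ∧ dilation z ≠ 0 ∧ angMom z 1 ≠ 0 := by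
  obtain ⟨z, hz⟩ := hne
  have hO1 : ∀ᶠ t in nhdsWithin (0 : ℝ) {0}ᶜ,
      (z.1 + t • EuclideanSpace.single (0 : Fin 3) (1 : ℝ), z.2) ∈ O := by
    refine nhdsWithin_le_nhds (ContinuousAt.eventually_mem ?_ (hO.mem_nhds (by simpa using hz)))
    fun_prop
  obtain ⟨t, htO, ht⟩ := (hO1.and (eventually_add_mul_ne_zero (z.1 0) one_ne_zero)).exists
  obtain ⟨x, p, hx, hxp⟩ : ∃ x p : E3, x 0 ≠ 0 ∧ (x, p) ∈ O := ⟨_, _, by simpa using ht, htO⟩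
  -- Here v = x + e₁ × x. Moving p along v changes ⟨x, p⟩ at rate |x|² and L₁ at rate x₀² + x₂²,
  -- both positive once x₀ ≠ 0.
  set v : E3 := x + !₂[x 2, 0, -x 0] with hv
  have hO2 : ∀ᶠ t in nhdsWithin (0 : ℝ) {0}ᶜ, (x, p + t • v) ∈ O := by
    refine nhdsWithin_le_nhds (ContinuousAt.eventually_mem ?_ (hO.mem_nhds (by simpa using hxp)))
    fun_prop
  have h1 : x 0 ^ 2 + x 1 ^ 2 + x 2 ^ 2 ≠ 0 := by positivity
  have h2 : x 0 ^ 2 + x 2 ^ 2 ≠ 0 := by positivity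
  obtain ⟨s, ⟨hsO, hs1⟩, hs2⟩ := ((hO2.and (eventually_add_mul_ne_zero (dilation (x, p)) h1)).and
    (eventually_add_mul_ne_zero (angMom (x, p) 1) h2)).exists
  refine ⟨_, hsO, hx, ?_, ?_⟩
  · convert hs1 using 1
    simp [dilation, hv, PiLp.inner_apply, Fin.sum_univ_three]
    ring
  · convert hs2 using 1
    simp [angMom_one, hv]
    ring

lemma angMomSq_pos_of_angMom_one {z : Phase} (h : angMom z 1 ≠ 0) : 0 < angMomSq z := by
  rw [angMomSq_eq_sum]
  positivity

namespace RadialSystem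

variable {B : RadialSystem}

/-- If `f` and its rotational derivative have no common generic zeros, then `f` is nonzero on a
dense set. -/
lemma exists_ne_zero_of_rotField {f g : Phase → ℝ} {O : Set Phase} (hO : IsOpen O)
    (hne : O.Nonempty)
    (hfg : ∀ z ∈ O, fderiv ℝ f z (rotField z) = g z)
    (h0 : ∀ z ∈ O, z.1 0 ≠ 0 → dilation z ≠ 0 → angMom z 1 ≠ 0 → f z ≠ 0 ∨ g z ≠ 0) :
    ∃ z ∈ O, dilation z ≠ 0 ∧ angMom z 1 ≠ 0 ∧ f z ≠ 0 := by
  set G := {z ∈ O | z.1 0 ≠ 0 ∧ dilation z ≠ 0 ∧ angMom z 1 ≠ 0} with hG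
  have hGo : IsOpen G :=
    hO.inter (((contDiff_coord_fst 0).continuous.isOpen_preimage _ isOpen_ne).inter
      ((contDiff_dilation.continuous.isOpen_preimage _ isOpen_ne).inter
        ((contDiff_angMom 1).continuous.isOpen_preimage _ isOpen_ne)))
  obtain ⟨z, hzO, hz⟩ := exists_generic_mem hO hne
  by_contra! hcon
  -- If f vanished at all generic points of `O`, it would vanish near `z`, and its rotational
  -- derivative g with it.
  have hfG : f =ᶠ[nhds z] fun _ => 0 :=
    Filter.eventuallyEq_of_mem (hGo.mem_nhds ⟨hzO, hz⟩) fun w hw => hcon w hw.1 hw.2.2.1 hw.2.2.2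
  have hg : g z = 0 := by
    rw [← hfg z hzO, hfG.fderiv_eq]
    simp
  exact (h0 z hzO hz.1 hz.2.1 hz.2.2).elim (· hfG.eq_of_nhds) (· hg)

lemma functionallyIndependent_of_rotField {F F' : Phase → ℝ}
    (hF : ∀ z ∈ B.phaseSpace, fderiv ℝ F z (rotField z) = F' z)
    (hF' : ContinuousOn F' B.phaseSpace)
    (hd : ∀ O ⊆ B.phaseSpace, IsOpen O → O.Nonempty →
      ∃ z ∈ O, dilation z ≠ 0 ∧ angMom z 1 ≠ 0 ∧ F' z ≠ 0) :
    B.FunctionallyIndependent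
      ![B.H, fun z => angMom z 0, fun z => angMom z 1, fun z => angMom z 2, F] := by
  refine ⟨(B.phaseSpace ∩ F' ⁻¹' {0}ᶜ) ∩ {z | dilation z ≠ 0 ∧ angMom z 1 ≠ 0},
    (hF'.isOpen_inter_preimage B.isOpen_phaseSpace isOpen_ne).inter
      ((contDiff_dilation.continuous.isOpen_preimage _ isOpen_ne).inter
        ((contDiff_angMom 1).continuous.isOpen_preimage _ isOpen_ne)),
    fun z hz => hz.1.1, fun z hz => ?_, fun z hz => ?_⟩
  · rw [mem_closure_iff]
    intro O hO hzO
    obtain ⟨w, hw, h1, h2, h3⟩ := hd (O ∩ B.phaseSpace) Set.inter_subset_right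
      (hO.inter B.isOpen_phaseSpace) ⟨z, hzO, hz⟩
    exact ⟨w, hw.1, ⟨hw.2, h3⟩, h1, h2⟩
  · refine linearIndependent_fderiv hz.1.1 hz.2.1 (angMomSq_pos_of_angMom_one hz.2.2).ne' ?_
    rw [hF z hz.1.1]
    exact hz.1.2

end RadialSystem

namespace Linearization

variable {B : RadialSystem} {κ : ℝ} (D : Linearization B κ) (m : ℕ) {n : ℕ}

/-! ### The invariant tensor of a linearization -/

/-- The linear map `v ↦ -⟨L × x / |x|, v⟩ + ω ⟨x / |x|, v⟩`. -/
def frameMap (z : Phase) : E3 →ₗ[ℝ] QuadraticAlgebra ℝ (-angMomSq z) 0 where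
  toFun v := ⟨-normalComp v z, radialComp v z⟩
  map_add' v w := by
    ext
    · simp only [normalComp, inner_add_right, QuadraticAlgebra.re_add]
      ring
    · simp only [radialComp, inner_add_right, QuadraticAlgebra.im_add]
      ring
  map_smul' c v := by
    ext
    · simp only [normalComp, inner_smul_right, QuadraticAlgebra.re_smul, smul_eq_mul,
        RingHom.id_apply]
      ring
    · simp only [radialComp, inner_smul_right, QuadraticAlgebra.im_smul, smul_eq_mul,
        RingHom.id_apply]
      ring

/-- The real parts of the factors of the amplitude. -/
def reFactor (v : Fin n → E3) : Fin m ⊕ Fin n → Phase → ℝ :=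
  Sum.elim (fun _ => D.displacement) fun k z => -normalComp (v k) z

/-- The imaginary parts of the factors of the amplitude. -/
def imFactor (v : Fin n → E3) : Fin m ⊕ Fin n → Phase → ℝ :=
  Sum.elim (fun _ => D.velocity) fun k z => radialComp (v k) z

/-- The complex amplitude: `m` factors rotating with the linearized motion and `n` factors rotating
backwards with the frame `x / |x|`, `L × x / |x|`. -/
def amplitude (v : Fin n → E3) (z : Phase) : QuadraticAlgebra ℝ (-angMomSq z) 0 :=
  ∏ i, ⟨D.reFactor m v i z, D.imFactor m v i z⟩

/-- The imaginary part of the amplitude as a tensor. -/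
def tensor (n : ℕ) (z : Phase) : MultilinearMap ℝ (fun _ : Fin n => E3) ℝ :=
  (({ toFun := QuadraticAlgebra.im
      map_add' := fun _ _ => rfl
      map_smul' := fun _ _ => rfl } : QuadraticAlgebra ℝ (-angMomSq z) 0 →ₗ[ℝ] ℝ) ∘ₗ
    LinearMap.mulLeft ℝ ((⟨D.displacement z, D.velocity z⟩ :
      QuadraticAlgebra ℝ (-angMomSq z) 0) ^ m)).compMultilinearMap
    ((MultilinearMap.mkPiAlgebra ℝ (Fin n) _).compLinearMap fun _ => frameMap z)

lemma tensor_apply (z : Phase) (v : Fin n → E3) : D.tensor m n z v =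
    ((⟨D.displacement z, D.velocity z⟩ : QuadraticAlgebra ℝ (-angMomSq z) 0) ^ m *
      ∏ k, (⟨-normalComp (v k) z, radialComp (v k) z⟩ :
        QuadraticAlgebra ℝ (-angMomSq z) 0)).im := rfl

lemma tensor_eq_im_amplitude (z : Phase) (v : Fin n → E3) :
    D.tensor m n z v = (D.amplitude m v z).im := by
  simp [tensor_apply, amplitude, reFactor, imFactor]

lemma contDiffOn_amplitude (v : Fin n → E3) :
    ContDiffOn ℝ ∞ (fun z => (D.amplitude m v z).re) B.phaseSpace ∧
    ContDiffOn ℝ ∞ (fun z => (D.amplitude m v z).im) B.phaseSpace := by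
  refine contDiffOn_prod_re_im contDiff_angMomSq.contDiffOn Finset.univ ?_ ?_
  · rintro (i | k)
    · exact D.contDiffOn_displacement
    · exact (B.contDiffOn_normalComp _).neg
  · rintro (i | k)
    · exact D.contDiffOn_velocity
    · exact B.contDiffOn_radialComp _

open RadialSystem

/-- Angular velocities add under multiplication, and the total m κ/r² - n/r² is zero. -/
lemma hasDerivAt_im_amplitude_flow (hκ : m * κ = n) (v : Fin n → E3) {γ : ℝ → Phase} {t : ℝ}
    (hz : γ t ∈ B.phaseSpace) (hγ : HasDerivAt γ (B.vectorField (γ t)) t) :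
    HasDerivAt (fun s => (D.amplitude m v (γ s)).im) 0 t := by
  have hγ' := vectorField_eq hz ▸ hγ
  have h := (hasDerivAt_prod_re_im (q := fun s => angMomSq (γ s))
    (f := fun i s => D.reFactor m v i (γ s)) (g := fun i s => D.imFactor m v i (γ s))
    (θ := Sum.elim (fun _ : Fin m => κ / ‖(γ t).1‖ ^ 2) fun _ : Fin n => -(1 / ‖(γ t).1‖ ^ 2))
    (hasDerivAt_angMomSq_sl hγ') Finset.univ ?_ ?_).2
  · refine h.congr_deriv ?_
    simp only [Fintype.sum_sum_type, Sum.elim_inl, Sum.elim_inr, Finset.sum_const,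
      Finset.card_univ, Fintype.card_fin, nsmul_eq_mul, ← hκ]
    ring
  · rintro (i | k)
    · exact D.hasDerivAt_displacement_flow hz hγ
    · refine (hasDerivAt_normalComp_sl (v k) hγ' (position_ne_zero hz)).neg.congr_deriv ?_
      simp [imFactor]
  · rintro (i | k)
    · exact D.hasDerivAt_velocity_flow hz hγ
    · refine (hasDerivAt_radialComp_sl (v k) hγ' (position_ne_zero hz)).congr_deriv ?_
      simp [reFactor]

/-- Rotation about L fixes r, p_r, |L|² and H, hence displacement and velocity; only the n frame
factors turn, each at rate -1. -/
lemma hasDerivAt_amplitude_rotField (v : Fin n → E3) {z : Phase} (hz : z ∈ B.phaseSpace) :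
    HasDerivAt (fun t : ℝ => (D.amplitude m v (z + t • rotField z)).re)
      (n * angMomSq z * (D.amplitude m v z).im) 0 ∧
    HasDerivAt (fun t : ℝ => (D.amplitude m v (z + t • rotField z)).im)
      (-(n * (D.amplitude m v z).re)) 0 := by
  have hl := hasDerivAt_line_slField z (-dilation z) (‖z.1‖ ^ 2) (-‖z.2‖ ^ 2)
  rw [← rotField_eq] at hl
  have e0 : z + (0 : ℝ) • rotField z = z := by simp
  have h1 : (z + (0 : ℝ) • rotField z).1 ≠ 0 := by simpa using position_ne_zero hz
  have hr0 := norm_ne_zero_iff.2 (position_ne_zero hz)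
  have hr : HasDerivAt (fun t : ℝ => ‖(z + t • rotField z).1‖) 0 0 := by
    refine (hasDerivAt_norm_sl hl h1).congr_deriv ?_
    rw [e0, radMom]
    field_simp
    ring
  have hp : HasDerivAt (fun t : ℝ => radMom (z + t • rotField z)) 0 0 := by
    refine (hasDerivAt_radMom_sl hl h1).congr_deriv ?_
    rw [e0, radMom, angMomSq]
    field_simp
    ring
  have hq := hasDerivAt_angMomSq_sl hl
  have hy := (D.hasDerivAt_y _ hz)
  have hβ := hasDerivAt_of_contDiffOn_radii D.β_smooth hz
  rw [show ‖z.1‖ = ‖(z + (0 : ℝ) • rotField z).1‖ by rw [e0]] at hy hβ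
  have hH := hasDerivAt_H (B := B) (by rwa [e0]) hr hp hq
  have h := hasDerivAt_prod_re_im (q := fun s : ℝ => angMomSq (z + s • rotField z))
    (f := fun i s => D.reFactor m v i (z + s • rotField z))
    (g := fun i s => D.imFactor m v i (z + s • rotField z))
    (θ := Sum.elim (fun _ : Fin m => 0) fun _ : Fin n => -1) hq Finset.univ ?_ ?_
  · simp only [Fintype.sum_sum_type, Sum.elim_inl, Sum.elim_inr, Finset.sum_const,
      Finset.card_univ, Fintype.card_fin, nsmul_eq_mul] at h
    refine ⟨h.1.congr_deriv ?_, h.2.congr_deriv ?_⟩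
    · change -((m * 0 + n * -1) * angMomSq (z + (0 : ℝ) • rotField z) *
        (D.amplitude m v (z + (0 : ℝ) • rotField z)).im) = _
      rw [e0]
      ring
    · change (m * 0 + n * -1) * (D.amplitude m v (z + (0 : ℝ) • rotField z)).re = _
      rw [e0]
      ring
  · rintro (i | k)
    · refine ((hq.mul (hy.comp (0 : ℝ) hr)).add
        (((hH.const_mul D.cE).add (hq.const_mul D.cL)).add_const D.c₀)).congr_deriv ?_
      simp
    · refine (hasDerivAt_normalComp_sl (v k) hl h1).neg.congr_deriv ?_
      simp only [imFactor, Sum.elim_inr, e0]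
      field_simp
  · rintro (i | k)
    · refine ((hβ.comp (0 : ℝ) hr).mul hp).congr_deriv ?_
      simp
    · refine (hasDerivAt_radialComp_sl (v k) hl h1).congr_deriv ?_
      simp only [reFactor, Sum.elim_inr, e0]
      field_simp

/-! ### Generic nonvanishing of the amplitude, and properties of the tensor -/

lemma fderiv_re_amplitude (v : Fin n → E3) {z : Phase} (hz : z ∈ B.phaseSpace) :
    fderiv ℝ (fun z => (D.amplitude m v z).re) z (rotField z) =
      n * angMomSq z * (D.amplitude m v z).im :=
  fderiv_eq_of_hasDerivAt_line
    (differentiableAt_of_contDiffOn (D.contDiffOn_amplitude m v).1 hz)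
    (D.hasDerivAt_amplitude_rotField m v hz).1

lemma fderiv_im_amplitude (v : Fin n → E3) {z : Phase} (hz : z ∈ B.phaseSpace) :
    fderiv ℝ (fun z => (D.amplitude m v z).im) z (rotField z) =
      -(n * (D.amplitude m v z).re) :=
  fderiv_eq_of_hasDerivAt_line
    (differentiableAt_of_contDiffOn (D.contDiffOn_amplitude m v).2 hz)
    (D.hasDerivAt_amplitude_rotField m v hz).2

/-- The amplitude of the first axis has no zeros at generic points. -/
lemma amplitude_ne_zero {z : Phase} (hz : z ∈ B.phaseSpace) (hx : z.1 0 ≠ 0)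
    (hd : dilation z ≠ 0) (hL : angMom z 1 ≠ 0) :
    D.amplitude m (fun _ : Fin n => EuclideanSpace.single 0 1) z ≠ 0 := by
  have hr := (norm_pos_of_mem hz).ne'
  refine prod_ne_zero_of_norm_pos (angMomSq_pos_of_angMom_one hL) Finset.univ ?_
  rintro (i | k)
  · exact Or.inr (mul_ne_zero (D.β_ne_zero _ hz) (div_ne_zero hd hr))
  · refine Or.inr (div_ne_zero ?_ hr)
    simpa [EuclideanSpace.inner_single_right] using hx

/-- If the real part vanished at generic points of an open set, so would its rotational derivative,
a nonzero multiple of the imaginary part there, contradicting `amplitude_ne_zero`. -/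
lemma exists_re_amplitude_ne_zero (hn : n ≠ 0) {O : Set Phase} (hOB : O ⊆ B.phaseSpace)
    (hO : IsOpen O) (hne : O.Nonempty) : ∃ z ∈ O, dilation z ≠ 0 ∧ angMom z 1 ≠ 0 ∧
      (D.amplitude m (fun _ : Fin n => EuclideanSpace.single 0 1) z).re ≠ 0 := by
  refine exists_ne_zero_of_rotField hO hne
    (fun z hz => D.fderiv_re_amplitude m _ (hOB hz)) fun z hz hx hd hL => ?_
  by_contra! h
  refine D.amplitude_ne_zero m (hOB hz) hx hd hL (n := n) (QuadraticAlgebra.ext h.1 ?_)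
  simpa [hn, (angMomSq_pos_of_angMom_one hL).ne'] using h.2

lemma exists_im_amplitude_ne_zero (hn : n ≠ 0) {O : Set Phase} (hOB : O ⊆ B.phaseSpace)
    (hO : IsOpen O) (hne : O.Nonempty) : ∃ z ∈ O, dilation z ≠ 0 ∧ angMom z 1 ≠ 0 ∧
      (D.amplitude m (fun _ : Fin n => EuclideanSpace.single 0 1) z).im ≠ 0 := by
  refine exists_ne_zero_of_rotField hO hne
    (fun z hz => D.fderiv_im_amplitude m _ (hOB hz)) fun z hz hx hd hL => ?_
  by_contra! h
  refine D.amplitude_ne_zero m (hOB hz) hx hd hL (n := n) (QuadraticAlgebra.ext ?_ h.1)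
  simpa [hn] using h.2

/-- Everything is built from inner products of x, p and the arguments, without the vector product,
so reflections are covered as well. -/
lemma tensor_map (z : Phase) (R : E3 ≃ₗᵢ[ℝ] E3) (v : Fin n → E3) :
    D.tensor m n (R z.1, R z.2) (fun k => R (v k)) = D.tensor m n z v := by
  have hd : dilation (R z.1, R z.2) = dilation z := R.inner_map_map _ _
  have hq : angMomSq (R z.1, R z.2) = angMomSq z := by simp [angMomSq, hd]
  have hp : radMom (R z.1, R z.2) = radMom z := by simp [radMom, hd]
  have hH : B.H (R z.1, R z.2) = B.H z := by simp [H_eq, hq, hp]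
  have h1 : D.displacement (R z.1, R z.2) = D.displacement z := by simp [displacement, hq, hH]
  have h2 : D.velocity (R z.1, R z.2) = D.velocity z := by simp [velocity, hp]
  have h3 : ∀ w, normalComp (R w) (R z.1, R z.2) = normalComp w z := by simp [normalComp, hd]
  have h4 : ∀ w, radialComp (R w) (R z.1, R z.2) = radialComp w z := by simp [radialComp]
  simp only [tensor_apply, h1, h2, h3, h4]
  rw [hq]

lemma isInvariantSymmetricTensorField (hκ : m * κ = n) :
    B.IsInvariantSymmetricTensorField (D.tensor m n) where
  smooth v := by
    simp only [tensor_eq_im_amplitude]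
    exact (D.contDiffOn_amplitude m v).2
  symmetric z _ σ v := by
    simp only [tensor_apply]
    rw [Equiv.prod_comp σ fun k => (⟨-normalComp (v k) z, radialComp (v k) z⟩ :
        QuadraticAlgebra ℝ (-angMomSq z) 0)]
  equivariant z _ R v := D.tensor_map m z R v
  invariant J γ hγ s hs t ht := by
    ext v
    simp only [tensor_eq_im_amplitude]
    exact isInvariant_of_hasDerivAt (F := fun z => (D.amplitude m v z).im)
      (fun γ t hz hγ => D.hasDerivAt_im_amplitude_flow m hκ v hz hγ) J γ hγ s hs t ht

lemma isNontrivial (hn : n ≠ 0) : B.IsNontrivial (D.tensor m n) := by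
  refine ⟨fun _ => 0, ?_⟩
  simp only [tensor_eq_im_amplitude]
  refine functionallyIndependent_of_rotField (fun z hz => D.fderiv_im_amplitude m _ hz)
    ((continuousOn_const.mul (D.contDiffOn_amplitude m _).1.continuousOn).neg)
    fun O hOB hO hne => ?_
  obtain ⟨z, hz, h1, h2, h3⟩ := D.exists_re_amplitude_ne_zero m hn hOB hO hne
  exact ⟨z, hz, h1, h2, neg_ne_zero.2 (mul_ne_zero (Nat.cast_ne_zero.2 hn) h3)⟩

end Linearization

/-! ### Linearizations of the two Bertrand families -/

namespace RadialSystem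

variable {B : RadialSystem} {m n : ℕ} {ε D K A G : ℝ}

lemma contDiffOn_sq_inv (B : RadialSystem) : ContDiffOn ℝ ∞ (fun r : ℝ => (r ^ 2)⁻¹) B.radii :=
  (contDiff_id.pow 2).contDiffOn.inv fun r hr => pow_ne_zero 2 (B.radii_pos r hr).ne'

namespace IsTypeI

lemma sqrt_arg_pos (hB : B.IsTypeI m n K A G) {r : ℝ} (hr : r ∈ B.radii) : 0 < (r ^ 2)⁻¹ + K := by
  have h0 := B.radii_pos r hr
  have h : (r ^ 2)⁻¹ + K = (1 + K * r ^ 2) / r ^ 2 := by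
    field_simp
  rw [h]
  exact div_pos (hB r hr).1 (by positivity)

/-- The inverse radius `√(r⁻² + K)` linearizes a system of type I. -/
def linearization (hB : B.IsTypeI m n K A G) (hm : 0 < m) (hn : 0 < n) :
    Linearization B (n / m) where
  -- The energy relation is 2H itself: p_r²/h² + |L|² (y² - K) + 2 (A y + G) = 2H.
  y r := √((r ^ 2)⁻¹ + K)
  β r := 1 / B.h r
  cE := 0
  cL := 0
  c₀ := A
  dE := 2
  dL := K
  d₀ := -2 * G
  y_smooth := (B.contDiffOn_sq_inv.add contDiffOn_const).sqrt
    fun r hr => (hB.sqrt_arg_pos hr).ne'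
  β_smooth := contDiffOn_const.div B.h_smooth fun r hr => (B.h_pos r hr).ne'
  β_ne_zero r hr := one_div_ne_zero (B.h_pos r hr).ne'
  hasDerivAt_y r hr := by
    have h0 := (B.radii_pos r hr)
    have hh := B.h_pos r hr
    have hy := hB.sqrt_arg_pos hr
    have hs := Real.sqrt_pos.2 hy
    have hm' : (0 : ℝ) < m := Nat.cast_pos.2 hm
    have hn' : (0 : ℝ) < n := Nat.cast_pos.2 hn
    have hd := (((hasDerivAt_id r).pow 2).inv (pow_ne_zero 2 h0.ne')).add_const K |>.sqrt hy.ne'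
    refine HasDerivAt.congr_deriv hd ?_
    have key : n * B.h r * √((r ^ 2)⁻¹ + K) * r = m := by
      refine (sq_eq_sq₀ (by positivity) hm'.le).1 ?_
      have e := (hB r hr).2.1
      have p := (hB r hr).1
      rw [mul_pow, mul_pow, mul_pow, Real.sq_sqrt hy.le, e]
      field_simp
    simp only [id, Pi.pow_apply, Pi.inv_apply]
    generalize √((r ^ 2)⁻¹ + K) = y at *
    field_simp
    norm_num
    linear_combination -2 * r * key
  radial r hr := by
    have hh := (B.h_pos r hr).ne'
    field_simp
    ring
  angular r hr := by
    rw [Real.sq_sqrt (hB.sqrt_arg_pos hr).le]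
    ring
  potential r hr := by
    rw [(hB r hr).2.2]
    ring

end IsTypeI

namespace IsTypeII

/-- The discriminant `Δ`. -/
def disc (D K r : ℝ) : ℝ := (1 - D * r ^ 2) ^ 2 - K * r ^ 4

/-- The function `(1 - D r² ± √Δ) / r²`. -/
def orbitVar (ε D K r : ℝ) : ℝ := (r ^ 2)⁻¹ - D + ε * (√(disc D K r) * (r ^ 2)⁻¹)

lemma disc_pos (hB : B.IsTypeII m n ε D K A G) {r : ℝ} (hr : r ∈ B.radii) : 0 < disc D K r := (hB r hr).1

lemma contDiffOn_orbitVar (hB : B.IsTypeII m n ε D K A G) :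
    ContDiffOn ℝ ∞ (orbitVar ε D K) B.radii := by
  have hd : ContDiff ℝ ∞ (disc D K) := by
    unfold disc
    fun_prop
  exact (B.contDiffOn_sq_inv.sub contDiffOn_const).add (contDiffOn_const.mul
    ((hd.contDiffOn.sqrt fun r hr => (hB.disc_pos hr).ne').mul B.contDiffOn_sq_inv))

lemma numerator_eq {r : ℝ} (hr : r ∈ B.radii) :
    1 - D * r ^ 2 + ε * √((1 - D * r ^ 2) ^ 2 - K * r ^ 4) = r ^ 2 * orbitVar ε D K r := by
  have h0 := (B.radii_pos r hr).ne'
  rw [orbitVar, disc]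
  field_simp

lemma h_sq (hB : B.IsTypeII m n ε D K A G) (hn : 0 < n) {r : ℝ} (hr : r ∈ B.radii) :
    B.h r ^ 2 * (n ^ 2 * disc D K r) = 2 * m ^ 2 * (r ^ 2 * orbitVar ε D K r) := by
  have hD := (hB.disc_pos hr).ne'
  have e := (hB r hr).2.1
  have hn' : (n : ℝ) ≠ 0 := Nat.cast_ne_zero.2 hn.ne'
  rw [numerator_eq hr] at e
  change B.h r ^ 2 = _ / (n ^ 2 * disc D K r) at e
  rw [e]
  field_simp

/-- Positivity, needed for the square root in β, is hidden in h² > 0. -/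
lemma orbitVar_pos (hB : B.IsTypeII m n ε D K A G) (hm : 0 < m) (hn : 0 < n)
    {r : ℝ} (hr : r ∈ B.radii) : 0 < orbitVar ε D K r := by
  have h0 := B.radii_pos r hr
  have hh := B.h_pos r hr
  have hD := hB.disc_pos hr
  have hm' : (0 : ℝ) < m := Nat.cast_pos.2 hm
  have hn' : (0 : ℝ) < n := Nat.cast_pos.2 hn
  have h : 0 < 2 * (m : ℝ) ^ 2 * (r ^ 2 * orbitVar ε D K r) := by
    rw [← hB.h_sq hn hr]
    positivity
  rw [← mul_assoc] at h
  exact pos_of_mul_pos_right h (by positivity)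

/-- The function is a root of y² - 2 (r⁻² - D) y + K = 0, whose reduced discriminant is Δ/r⁴. This
makes 2y/r² a polynomial in y. -/
lemma orbitVar_quadratic (hB : B.IsTypeII m n ε D K A G) (hε : ε = 1 ∨ ε = -1)
    {r : ℝ} (hr : r ∈ B.radii) :
    orbitVar ε D K r ^ 2 + 2 * D * orbitVar ε D K r - 2 * orbitVar ε D K r * (r ^ 2)⁻¹ = -K := by
  have h0 := (B.radii_pos r hr).ne'
  have hε2 : ε ^ 2 = 1 := by rcases hε with rfl | rfl <;> norm_num
  have hs := Real.sq_sqrt (hB.disc_pos hr).le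
  rw [orbitVar]
  generalize hS : √(disc D K r) = S at *
  rw [disc] at hs
  field_simp
  linear_combination ε ^ 2 * hs + ((1 - D * r ^ 2) ^ 2 - K * r ^ 4) * hε2

lemma hasDerivAt_orbitVar (hB : B.IsTypeII m n ε D K A G) (hε : ε = 1 ∨ ε = -1)
    {r : ℝ} (hr : r ∈ B.radii) :
    HasDerivAt (orbitVar ε D K) (-(2 * ε * orbitVar ε D K r / (r * √(disc D K r)))) r := by
  have h0 := (B.radii_pos r hr).ne'
  have hD := hB.disc_pos hr
  have hS0 := (Real.sqrt_pos.2 hD).ne'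
  have hε2 : ε ^ 2 = 1 := by rcases hε with rfl | rfl <;> norm_num
  have hs := Real.sq_sqrt hD.le
  have hi := ((hasDerivAt_id r).pow 2).inv (pow_ne_zero 2 h0)
  have hd : HasDerivAt (disc D K) _ r :=
    ((((hasDerivAt_id r).pow 2).const_mul D).const_sub 1 |>.pow 2).sub
      (((hasDerivAt_id r).pow 4).const_mul K)
  have h : HasDerivAt (orbitVar ε D K) _ r :=
    (hi.sub_const D).add (((hd.sqrt hD.ne').mul hi).const_mul ε)
  refine h.congr_deriv ?_
  simp only [id, Pi.pow_apply, Pi.inv_apply, orbitVar]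
  generalize hS : √(disc D K r) = S at *
  rw [disc] at hs
  norm_num
  field_simp
  linear_combination -4 * ε * hs + 4 * S * hε2

/-- The function `(1 - D r² ± √Δ) / r²` linearizes a system of type II. -/
def linearization (hB : B.IsTypeII m n ε D K A G) (hε : ε = 1 ∨ ε = -1)
    (hm : 0 < m) (hn : 0 < n) : Linearization B (n / m) where
  -- Since V = A/y + G, these constants come from multiplying p_r²/h² + |L|²/r² + 2V = 2H by 2y and
  -- replacing 2y/r² by y² + 2D y + K. The factor ε in β records the sign of the derivative of y.
  y := orbitVar ε D K
  β r := ε * √(2 * orbitVar ε D K r) / B.h r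
  cE := -2
  cL := D
  c₀ := 2 * G
  dE := 0
  dL := -K
  d₀ := -4 * A
  y_smooth := hB.contDiffOn_orbitVar
  β_smooth := (contDiffOn_const.mul ((contDiffOn_const.mul hB.contDiffOn_orbitVar).sqrt
    fun r hr => (mul_pos two_pos (hB.orbitVar_pos hm hn hr)).ne')).div B.h_smooth
      fun r hr => (B.h_pos r hr).ne'
  β_ne_zero r hr := by
    have hh := B.h_pos r hr
    have hy := hB.orbitVar_pos hm hn hr
    have h2 : √(2 * orbitVar ε D K r) ≠ 0 := by positivity
    have hε0 : ε ≠ 0 := by rcases hε with rfl | rfl <;> norm_num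
    positivity
  hasDerivAt_y r hr := by
    have h0 := (B.radii_pos r hr)
    have hh := B.h_pos r hr
    have hy := hB.orbitVar_pos hm hn hr
    have hD := Real.sqrt_pos.2 (hB.disc_pos hr)
    have hm' : (0 : ℝ) < m := Nat.cast_pos.2 hm
    have hn' : (0 : ℝ) < n := Nat.cast_pos.2 hn
    refine (hB.hasDerivAt_orbitVar hε hr).congr_deriv ?_
    have hw := Real.sqrt_nonneg (2 * orbitVar ε D K r)
    have hw2 := Real.sq_sqrt (show 0 ≤ 2 * orbitVar ε D K r by positivity)
    have key : B.h r * n * √(disc D K r) = m * r * √(2 * orbitVar ε D K r) := by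
      refine (sq_eq_sq₀ (by positivity) (by positivity)).1 ?_
      rw [mul_pow, mul_pow, mul_pow, mul_pow, hw2, Real.sq_sqrt (hB.disc_pos hr).le]
      linear_combination hB.h_sq hn hr
    generalize √(disc D K r) = S at *
    generalize √(2 * orbitVar ε D K r) = w at *
    generalize orbitVar ε D K r = y at *
    field_simp
    linear_combination ε * w * key + ε * m * r * hw2
  radial r hr := by
    have hh := (B.h_pos r hr).ne'
    have hε2 : ε ^ 2 = 1 := by rcases hε with rfl | rfl <;> norm_num
    have hw2 := Real.sq_sqrt (show 0 ≤ 2 * orbitVar ε D K r by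
      have := hB.orbitVar_pos hm hn hr
      positivity)
    field_simp
    rw [hw2, hε2]
    ring
  angular r hr := by
    linear_combination hB.orbitVar_quadratic hε hr
  potential r hr := by
    have h0 := (B.radii_pos r hr).ne'
    have hy := (hB.orbitVar_pos hm hn hr).ne'
    rw [(hB r hr).2.2, numerator_eq hr]
    field_simp
    ring

end IsTypeII

end RadialSystem

namespace RadialSystem

variable {B : RadialSystem} {m n : ℕ} {K A G A' G' : ℝ}

/-! ### The Kepler problem -/

lemma exists_ne_mem_radii (B : RadialSystem) : ∃ r ∈ B.radii, ∃ s ∈ B.radii, r ≠ s := by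
  obtain ⟨r, hr⟩ := B.radii_nonempty
  have h : ∀ᶠ t in nhdsWithin r {r}ᶜ, t ∈ B.radii :=
    nhdsWithin_le_nhds (B.radii_open.mem_nhds hr)
  obtain ⟨s, hs, hne⟩ := (h.and self_mem_nhdsWithin).exists
  exact ⟨r, hr, s, hs, Ne.symm hne⟩

namespace IsTypeI

/-- One tensor must serve every choice of constants describing the same system, so A has to be
determined by V; two radii suffice. -/
lemma coupling_unique (h : B.IsTypeI m n 0 A G) (h' : B.IsTypeI m n 0 A' G') : A = A' := by
  obtain ⟨r, hr, s, hs, hne⟩ := B.exists_ne_mem_radii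
  have e : ∀ t ∈ B.radii, A * t⁻¹ + G = A' * t⁻¹ + G' := fun t ht => by
    have := (h t ht).2.2.symm.trans (h' t ht).2.2
    rwa [add_zero, ← inv_pow, Real.sqrt_sq (inv_nonneg.2 (B.radii_pos t ht).le)] at this
  have h1 := e r hr
  have h2 := e s hs
  have h3 : (A - A') * (r⁻¹ - s⁻¹) = 0 := by linear_combination h1 - h2
  rcases mul_eq_zero.1 h3 with h4 | h4
  · linarith
  · exact absurd (inv_injective (sub_eq_zero.1 h4)) hne

lemma h_eq_one (hB : B.IsTypeI 1 1 0 A G) {r : ℝ} (hr : r ∈ B.radii) : B.h r = 1 := by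
  have h := (hB r hr).2.1
  have hp := B.h_pos r hr
  norm_num at h
  exact h.resolve_right (by linarith)

lemma inner_rungeLenz (z : Phase) (v : E3) : ⟪rungeLenz A z, v⟫ =
    ⟪z.1, v⟫ * ‖z.2‖ ^ 2 - dilation z * ⟪z.2, v⟫ + A / ‖z.1‖ * ⟪z.1, v⟫ := by
  rw [rungeLenz, angMom, cross_cross, real_inner_self_eq_norm_sq, real_inner_comm]
  simp only [dilation, inner_add_right, inner_sub_right, inner_smul_right, real_inner_comm]
  ring

lemma tensor_eq_rungeLenz (hB : B.IsTypeI 1 1 0 A G) {z : Phase} (hz : z ∈ B.phaseSpace)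
    (v : Fin 1 → E3) :
    (hB.linearization one_pos one_pos).tensor 1 1 z v = ∏ k, ⟪rungeLenz A z, v k⟫ := by
  have hr := norm_pos_of_mem hz
  have hy : (hB.linearization one_pos one_pos).y ‖z.1‖ = ‖z.1‖⁻¹ := by
    change √((‖z.1‖ ^ 2)⁻¹ + 0) = _
    rw [add_zero, ← inv_pow, Real.sqrt_sq (inv_nonneg.2 hr.le)]
  have hβ : (hB.linearization one_pos one_pos).β ‖z.1‖ = 1 := by
    change 1 / B.h ‖z.1‖ = 1
    rw [hB.h_eq_one hz, div_one]
  have hdis : (hB.linearization one_pos one_pos).displacement z = angMomSq z * ‖z.1‖⁻¹ + A := by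
    rw [Linearization.displacement, hy]
    change _ + (0 * B.H z + 0 * angMomSq z + A) = _
    ring
  rw [Linearization.tensor_apply, Fin.prod_univ_one, Fin.prod_univ_one, pow_one,
    QuadraticAlgebra.im_mul, inner_rungeLenz, hdis, Linearization.velocity, hβ]
  simp only [angMomSq, radialComp, normalComp, radMom]
  field_simp
  ring

end IsTypeI

/-! ### The harmonic oscillator -/

/-- The Fradkin tensor `p ⊗ ⋯ ⊗ p + A x ⊗ ⋯ ⊗ x`. -/
def fradkin (A : ℝ) (n : ℕ) (z : Phase) : MultilinearMap ℝ (fun _ : Fin n => E3) ℝ :=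
  (MultilinearMap.mkPiAlgebra ℝ (Fin n) ℝ).compLinearMap (fun _ => (innerSL ℝ z.2).toLinearMap) +
    A • (MultilinearMap.mkPiAlgebra ℝ (Fin n) ℝ).compLinearMap
      (fun _ => (innerSL ℝ z.1).toLinearMap)

lemma fradkin_apply (A : ℝ) (z : Phase) (v : Fin n → E3) :
    fradkin A n z v = (∏ k, ⟪z.2, v k⟫) + A * ∏ k, ⟪z.1, v k⟫ := rfl

lemma contDiff_fradkin (A : ℝ) (v : Fin n → E3) : ContDiff ℝ ∞ fun z => fradkin A n z v := by
  simp only [fradkin_apply]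
  exact (contDiff_prod fun k _ => contDiff_snd.inner ℝ contDiff_const).add
    (contDiff_const.mul (contDiff_prod fun k _ => contDiff_fst.inner ℝ contDiff_const))

namespace IsTypeII

lemma V_eq_oscillator (hB : B.IsTypeII m n 1 0 0 A G) {r : ℝ} (hr : r ∈ B.radii) :
    B.V r = A / 2 * r ^ 2 + G := by
  have h := (hB r hr).2.2
  norm_num at h
  rw [h]
  ring

lemma oscillator_coupling_unique (h : B.IsTypeII m n 1 0 0 A G)
    (h' : B.IsTypeII m n 1 0 0 A' G') : A = A' := by
  obtain ⟨r, hr, s, hs, hne⟩ := B.exists_ne_mem_radii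
  have h1 := (h.V_eq_oscillator hr).symm.trans (h'.V_eq_oscillator hr)
  have h2 := (h.V_eq_oscillator hs).symm.trans (h'.V_eq_oscillator hs)
  have h3 : (A - A') * (r ^ 2 - s ^ 2) = 0 := by linear_combination 2 * h1 - 2 * h2
  rcases mul_eq_zero.1 h3 with h4 | h4
  · linarith
  · exact absurd ((sq_eq_sq₀ (B.radii_pos r hr).le (B.radii_pos s hs).le).1
      (sub_eq_zero.1 h4)) hne

lemma h_eq_one (hB : B.IsTypeII 1 2 1 0 0 A G) {r : ℝ} (hr : r ∈ B.radii) : B.h r = 1 := by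
  have h := (hB r hr).2.1
  have hp := B.h_pos r hr
  norm_num at h
  exact h.resolve_right (by linarith)

lemma vectorField_oscillator (hB : B.IsTypeII 1 2 1 0 0 A G) {z : Phase}
    (hz : z ∈ B.phaseSpace) : B.vectorField z = (z.2, (-A) • z.1) := by
  have h0 := (norm_pos_of_mem hz).ne'
  have h1 : deriv B.h ‖z.1‖ = 0 :=
    hasDerivAt_eq_of_eqOn hz (fun s hs => hB.h_eq_one hs)
      (hasDerivAt_of_contDiffOn_radii B.h_smooth hz) (hasDerivAt_const _ _)
  have h2 : deriv B.V ‖z.1‖ = A * ‖z.1‖ := by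
    refine (hasDerivAt_eq_of_eqOn hz (fun s hs => hB.V_eq_oscillator hs)
      (hasDerivAt_of_contDiffOn_radii B.V_smooth hz)
      ((((hasDerivAt_id ‖z.1‖).pow 2).const_mul (A / 2)).add_const G)).trans ?_
    simp
    ring
  have h3 : B.velCoeff z = 0 := by simp [velCoeff, hB.h_eq_one hz]
  have h4 : B.forceCoeff z = -A := by
    rw [forceCoeff, h1, h2, h3]
    field_simp
    ring
  rw [vectorField_eq hz, h3, h4]
  simp

lemma isInvariant_fradkin (hB : B.IsTypeII 1 2 1 0 0 A G) :
    B.IsInvariant (fradkin A 2) := by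
  intro J γ hγ s hs t ht
  ext v
  refine isInvariant_of_hasDerivAt (F := fun z => fradkin A 2 z v)
    (fun γ t hz hγ => ?_) J γ hγ s hs t ht
  rw [hB.vectorField_oscillator hz] at hγ
  have hx := fun k => (hasDerivAt_position hγ).inner ℝ (hasDerivAt_const t (v k))
  have hp := fun k => (hasDerivAt_momentum hγ).inner ℝ (hasDerivAt_const t (v k))
  simp only [fradkin_apply, Fin.prod_univ_two]
  refine (((hp 0).mul (hp 1)).add (((hx 0).mul (hx 1)).const_mul A)).congr_deriv ?_
  simp only [inner_zero_right, inner_smul_left, conj_trivial]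
  ring

/-- The rotational derivative of the Fradkin tensor is the invariant tensor of the
linearization. -/
lemma fderiv_fradkin (hB : B.IsTypeII 1 2 1 0 0 A G) (v : E3) {z : Phase}
    (hz : z ∈ B.phaseSpace) :
    fderiv ℝ (fun z => fradkin A 2 z fun _ => v) z (rotField z) =
      ((hB.linearization (Or.inl rfl) one_pos two_pos).amplitude 1 (fun _ : Fin 2 => v) z).im := by
  have hr := norm_pos_of_mem hz
  set D := hB.linearization (Or.inl rfl) one_pos two_pos with hD
  have hy : D.y ‖z.1‖ = 2 * (‖z.1‖ ^ 2)⁻¹ := by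
    change orbitVar 1 0 0 ‖z.1‖ = _
    rw [orbitVar, disc]
    norm_num
    ring
  have hβ : D.β ‖z.1‖ = 2 / ‖z.1‖ := by
    change 1 * √(2 * D.y ‖z.1‖) / B.h ‖z.1‖ = _
    rw [hB.h_eq_one hz, hy, show 2 * (2 * (‖z.1‖ ^ 2)⁻¹) = (2 / ‖z.1‖) ^ 2 by ring,
      Real.sqrt_sq (by positivity)]
    ring
  have hdis : D.displacement z = angMomSq z * (2 * (‖z.1‖ ^ 2)⁻¹) -
      (radMom z ^ 2 + angMomSq z / ‖z.1‖ ^ 2 + A * ‖z.1‖ ^ 2) := by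
    rw [Linearization.displacement, hy]
    change _ + (-2 * B.H z + 0 * angMomSq z + 2 * G) = _
    rw [H_eq, hB.h_eq_one hz, hB.V_eq_oscillator hz]
    ring
  have hl := hasDerivAt_line z (rotField z)
  have hx := (hasDerivAt_position hl).inner ℝ (hasDerivAt_const (0 : ℝ) v)
  have hp := (hasDerivAt_momentum hl).inner ℝ (hasDerivAt_const (0 : ℝ) v)
  refine fderiv_eq_of_hasDerivAt_line ((contDiff_fradkin A _).differentiable (by simp) z) ?_
  simp only [fradkin_apply, Fin.prod_univ_two]
  refine ((hp.mul hp).add ((hx.mul hx).const_mul A)).congr_deriv ?_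
  rw [← Linearization.tensor_eq_im_amplitude, Linearization.tensor_apply, Fin.prod_univ_two,
    pow_one, QuadraticAlgebra.im_mul, QuadraticAlgebra.im_mul, QuadraticAlgebra.re_mul, hdis,
    Linearization.velocity, hβ]
  simp only [zero_smul, add_zero, inner_zero_right, inner_add_left, inner_sub_left,
    inner_smul_left, conj_trivial, zero_mul, zero_add]
  simp only [angMomSq, radialComp, normalComp, radMom]
  field_simp
  ring

lemma isInvariantSymmetricTensorField_fradkin (hB : B.IsTypeII 1 2 1 0 0 A G) :
    B.IsInvariantSymmetricTensorField (fradkin A 2) where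
  smooth v := (contDiff_fradkin A v).contDiffOn
  symmetric z _ σ v := by
    simp only [fradkin_apply]
    rw [Equiv.prod_comp σ fun k => ⟪z.2, v k⟫, Equiv.prod_comp σ fun k => ⟪z.1, v k⟫]
  equivariant z _ R v := by simp [fradkin_apply]
  invariant := hB.isInvariant_fradkin

/-- The rotational derivative is now the imaginary part of the amplitude, so its nonvanishing
replaces that of the real part. -/
lemma isNontrivial_fradkin (hB : B.IsTypeII 1 2 1 0 0 A G) : B.IsNontrivial (fradkin A 2) := by
  set D := hB.linearization (Or.inl rfl) one_pos two_pos
  exact ⟨fun _ => 0, functionallyIndependent_of_rotField (fun z hz => hB.fderiv_fradkin _ hz)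
    (D.contDiffOn_amplitude 1 _).2.continuousOn
    fun O hOB hO hne => D.exists_im_amplitude_ne_zero 1 two_ne_zero hOB hO hne⟩

end IsTypeII

/-! ### Superintegrability -/

lemma poisson_angMomSq_H {z : Phase} (hz : z ∈ B.phaseSpace) : poisson angMomSq B.H z = 0 := by
  rw [poisson_eq_fderiv (contDiff_angMomSq.differentiable (by simp) z)]
  change fderiv ℝ angMomSq z (B.vectorField z) = 0
  rw [vectorField_eq hz]
  exact fderiv_eq_of_hasDerivAt_line (contDiff_angMomSq.differentiable (by simp) z)
    (hasDerivAt_angMomSq_sl (hasDerivAt_line_slField z _ _ _))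

lemma poisson_angMom_H (i : Fin 3) {z : Phase} (hz : z ∈ B.phaseSpace) :
    poisson (fun z => angMom z i) B.H z = 0 := by
  rw [poisson_eq_fderiv ((contDiff_angMom i).differentiable (by simp) z)]
  change fderiv ℝ _ z (B.vectorField z) = 0
  rw [vectorField_eq hz]
  exact fderiv_angMom_slField z _ _ _ i

lemma gradient_angMomSq (z : Phase) : (gradient (fun p => angMomSq (z.1, p)) z.2,
    -gradient (fun x => angMomSq (x, z.2)) z.1) =
      slField (-2 * dilation z) (2 * ‖z.1‖ ^ 2) (-2 * ‖z.2‖ ^ 2) z := by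
  have hd := contDiff_angMomSq.differentiable (by simp) z
  have key : ∀ ξ η : E3, fderiv ℝ angMomSq z (ξ, η) =
      2 * ⟪z.1, ξ⟫ * ‖z.2‖ ^ 2 + ‖z.1‖ ^ 2 * (2 * ⟪z.2, η⟫) -
        2 * dilation z * (⟪z.1, η⟫ + ⟪ξ, z.2⟫) := by
    intro ξ η
    refine fderiv_eq_of_hasDerivAt_line hd
      ((hasDerivAt_angMomSq (hasDerivAt_line z (ξ, η))).congr_deriv ?_)
    simp
  refine Prod.ext (ext_inner_right ℝ fun v => ?_) (ext_inner_right ℝ fun v => ?_)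
  · rw [inner_gradient_snd hd, key]
    simp only [slField, inner_add_left, inner_smul_left, conj_trivial, inner_zero_right,
      inner_zero_left]
    ring
  · rw [inner_neg_left, inner_gradient_fst hd, key]
    simp only [slField, inner_sub_left, inner_smul_left, conj_trivial, inner_zero_right,
      real_inner_comm v z.2]
    ring

lemma poisson_angMom_angMomSq (i : Fin 3) (z : Phase) :
    poisson (fun z => angMom z i) angMomSq z = 0 := by
  rw [poisson_eq_fderiv ((contDiff_angMom i).differentiable (by simp) z), gradient_angMomSq]
  exact fderiv_angMom_slField z _ _ _ i

lemma fderiv_angMomSq (z : Phase) : fderiv ℝ angMomSq z =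
    (2 * angMom z 0) • fderiv ℝ (fun z => angMom z 0) z +
    (2 * angMom z 1) • fderiv ℝ (fun z => angMom z 1) z +
    (2 * angMom z 2) • fderiv ℝ (fun z => angMom z 2) z := by
  have h : ∀ i, HasFDerivAt (fun z => angMom z i) (fderiv ℝ (fun z => angMom z i) z) z :=
    fun i => ((contDiff_angMom i).differentiable (by simp) z).hasFDerivAt
  have e : angMomSq = fun z => angMom z 0 ^ 2 + angMom z 1 ^ 2 + angMom z 2 ^ 2 :=
    funext angMomSq_eq_sum
  conv_lhs => rw [e]
  refine ((((h 0).pow 2).add ((h 1).pow 2)).add ((h 2).pow 2)).fderiv.trans ?_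
  simp

/-- An additional integral independent of the energy and the angular momentum makes the system
maximally superintegrable. -/
lemma isMaximallySuperintegrable_of_functionallyIndependent {F : Phase → ℝ}
    (hF : ContDiffOn ℝ ∞ F B.phaseSpace) (hFi : B.IsInvariant F)
    (hind : B.FunctionallyIndependent
      ![B.H, fun z => angMom z 0, fun z => angMom z 1, fun z => angMom z 2, F]) :
    B.IsMaximallySuperintegrable := by
  -- H, |L|² and L₂ are in involution; L₀ and F complete the list.
  refine ⟨![B.H, angMomSq, fun z => angMom z 2, fun z => angMom z 0, F], rfl, ?_, ?_, ?_⟩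
  · intro i
    fin_cases i
    · exact ⟨B.contDiffOn_H, B.isInvariant_H⟩
    · exact ⟨contDiff_angMomSq.contDiffOn, B.isInvariant_angMomSq⟩
    · exact ⟨(contDiff_angMom 2).contDiffOn, B.isInvariant_angMom 2⟩
    · exact ⟨(contDiff_angMom 0).contDiffOn, B.isInvariant_angMom 0⟩
    · exact ⟨hF, hFi⟩
  · intro i j hi hj z hz
    have h1 := poisson_angMomSq_H hz
    have h2 := poisson_angMom_H 2 hz
    have h3 := poisson_angMom_angMomSq 2 z
    have h1' : poisson B.H angMomSq z = 0 := by rw [poisson_symm, h1, neg_zero]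
    have h2' : poisson B.H (fun z => angMom z 2) z = 0 := by rw [poisson_symm, h2, neg_zero]
    have h3' : poisson angMomSq (fun z => angMom z 2) z = 0 := by rw [poisson_symm, h3, neg_zero]
    have hcases : ∀ k : Fin 5, k < 3 → k = 0 ∨ k = 1 ∨ k = 2 := by decide
    rcases hcases i hi with rfl | rfl | rfl <;> rcases hcases j hj with rfl | rfl | rfl
    exacts [poisson_self _ z, h1', h2', h1, poisson_self _ z, h3', h2, h3, poisson_self _ z]
  · obtain ⟨U, hU, hUB, hUd, hUi⟩ := hind
    refine ⟨U ∩ {z | angMom z 1 ≠ 0},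
      hU.inter ((contDiff_angMom 1).continuous.isOpen_preimage _ isOpen_ne),
      fun z hz => hUB hz.1, fun z hz => ?_, fun z hz => ?_⟩
    · rw [mem_closure_iff]
      intro O hO hzO
      obtain ⟨w, hw, -, -, hw1⟩ := exists_generic_mem (hO.inter hU)
        (mem_closure_iff.1 (hUd hz) O hO hzO)
      exact ⟨w, hw.1, hw.2, hw1⟩
    · have h1 : angMom z 1 ≠ 0 := hz.2
      have hli := Fintype.linearIndependent_iff.1 (hUi z hz.1)
      rw [Fintype.linearIndependent_iff]
      intro g hg
      -- As d|L|² = 2 ∑ Lᵢ dLᵢ, a relation among the new five gives one among the old five. Its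
      -- L₁-coefficient is 2 L₁ times that of |L|², which therefore vanishes where L₁ ≠ 0.
      have hs := hli ![g 0, g 3 + g 1 * (2 * angMom z 0), g 1 * (2 * angMom z 1),
        g 2 + g 1 * (2 * angMom z 2), g 4] (by
          rw [← hg]
          simp only [Fin.sum_univ_five, Matrix.cons_val, fderiv_angMomSq, smul_add, smul_smul,
            add_smul]
          abel)
      have s0 := hs 0
      have s1 := hs 1
      have s2 := hs 2
      have s3 := hs 3
      have s4 := hs 4
      simp only [Matrix.cons_val, Matrix.cons_val_zero, Matrix.cons_val_one] at s0 s1 s2 s3 s4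
      have g1 : g 1 = 0 := by simpa [h1] using s2
      rw [g1, zero_mul, add_zero] at s1 s3
      intro i
      fin_cases i <;> assumption

lemma isMaximallySuperintegrable_of_tensor
    {C : Phase → MultilinearMap ℝ (fun _ : Fin n => E3) ℝ}
    (hC : B.IsInvariantSymmetricTensorField C) (hC' : B.IsNontrivial C) :
    B.IsMaximallySuperintegrable := by
  obtain ⟨c, hc⟩ := hC'
  refine isMaximallySuperintegrable_of_functionallyIndependent (hC.smooth _) ?_ hc
  intro J γ hγ s hs t ht
  exact congrArg (fun T => T fun k => EuclideanSpace.single (c k) 1) (hC.invariant J γ hγ s hs t ht)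

/-! ### Choice of the tensor and conclusion -/

lemma IsBertrand.exists_linearization (hB : B.IsBertrand m n) :
    Nonempty (Linearization B (n / m)) := by
  obtain ⟨hm, hn, -, ⟨K, A, G, h⟩ | ⟨ε, D, K, A, G, hε, h⟩⟩ := hB
  · exact ⟨h.linearization hm hn⟩
  · exact ⟨h.linearization hε hm hn⟩

lemma IsBertrand.exists_tensor (hB : B.IsBertrand m n) :
    ∃ C : Phase → MultilinearMap ℝ (fun _ : Fin n => E3) ℝ,
      B.IsInvariantSymmetricTensorField C ∧ B.IsNontrivial C ∧
      (∀ A G : ℝ, m = 1 → n = 1 → B.IsTypeI m n 0 A G → ∀ z ∈ B.phaseSpace,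
        ∀ v, C z v = ∏ k, ⟪rungeLenz A z, v k⟫) ∧
      (∀ A G : ℝ, m = 1 → n = 2 → B.IsTypeII m n 1 0 0 A G → ∀ z ∈ B.phaseSpace,
        ∀ v, C z v = (∏ k, ⟪z.2, v k⟫) + A * ∏ k, ⟪z.1, v k⟫) := by
  have hm := hB.1
  have hn := hB.2.1
  have hκ : (m : ℝ) * (n / m) = n := mul_div_cancel₀ _ (Nat.cast_ne_zero.2 hm.ne')
  -- The oscillator is split off because its linearization yields only the rotational derivative of
  -- the Fradkin tensor. Kepler is split off to use the type I linearization specifically; elsewhere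
  -- both normalizations are vacuous.
  by_cases hO : m = 1 ∧ n = 2 ∧ ∃ A G, B.IsTypeII m n 1 0 0 A G
  · obtain ⟨rfl, rfl, A, G, h⟩ := hO
    refine ⟨fradkin A 2, h.isInvariantSymmetricTensorField_fradkin, h.isNontrivial_fradkin,
      fun _ _ _ h2 => absurd h2 (by norm_num), fun A' G' _ _ h' z _ v => ?_⟩
    rw [h'.oscillator_coupling_unique h]
    rfl
  by_cases hK : m = 1 ∧ n = 1 ∧ ∃ A G, B.IsTypeI m n 0 A G
  · obtain ⟨rfl, rfl, A, G, h⟩ := hK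
    refine ⟨(h.linearization hm hn).tensor 1 1,
      (h.linearization hm hn).isInvariantSymmetricTensorField 1 hκ,
      (h.linearization hm hn).isNontrivial 1 one_ne_zero, fun A' G' _ _ h' z hz v => ?_,
      fun _ _ _ h2 => absurd h2 (by norm_num)⟩
    rw [h'.coupling_unique h]
    exact h.tensor_eq_rungeLenz hz v
  obtain ⟨D⟩ := hB.exists_linearization
  exact ⟨D.tensor m n, D.isInvariantSymmetricTensorField m hκ, D.isNontrivial m hn.ne',
    fun A G h1 h2 h => absurd ⟨h1, h2, A, G, h⟩ hK,
    fun A G h1 h2 h => absurd ⟨h1, h2, A, G, h⟩ hO⟩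

end RadialSystem

end Bertrand

end

theorem theorem6 (B : Bertrand.RadialSystem) (m n : ℕ) (hB : B.IsBertrand m n) :
    (∃ C : Bertrand.Phase → MultilinearMap ℝ (fun _ : Fin n => Bertrand.E3) ℝ,
      B.IsInvariantSymmetricTensorField C ∧ B.IsNontrivial C ∧
      -- Euclidean Kepler problem: the Runge--Lenz vector
      (∀ A G : ℝ, m = 1 → n = 1 → B.IsTypeI m n 0 A G → ∀ z ∈ B.phaseSpace,
        ∀ v, C z v = ∏ k, inner ℝ (Bertrand.rungeLenz A z) (v k)) ∧
      -- Euclidean harmonic oscillator: the Fradkin tensor `p ⊗ p + A x ⊗ x`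
      (∀ A G : ℝ, m = 1 → n = 2 → B.IsTypeII m n 1 0 0 A G → ∀ z ∈ B.phaseSpace,
        ∀ v, C z v = (∏ k, inner ℝ z.2 (v k)) + A * ∏ k, inner ℝ z.1 (v k))) ∧
    B.IsMaximallySuperintegrable := by
  obtain ⟨C, hC, hC', hrest⟩ := hB.exists_tensor
  exact ⟨⟨C, hC, hC', hrest⟩, Bertrand.RadialSystem.isMaximallySuperintegrable_of_tensor hC hC'⟩
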